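/- Let $\mathbb K$ be $\mathbb R$ or $\mathbb C$. All objects below (manifolds, forms, vector fields, distributions) are of class $C^\infty$ or real analytic if $\mathbb K=\mathbb R$, and complex analytic if $\mathbb K=\mathbb C$; manifolds are finite-dimensional, Hausdorff, second countable and without boundary. A pair $(\omega_0,\omega_1)$ of differential $2$-forms on a manifold $M$ is called compatible (a non-degenerate bi-Hamiltonian structure) if $\omega_0$ is non-degenerate, $d\omega_0=d\omega_1=0$, and the Nijenhuis tensor of the field of endomorphisms $P=\omega_0^{-1}\omega_1$ (that is, $\omega_0(Pu,v)=\omega_1(u,v)$) vanishes: $$[PX,PY]-P[PX,Y]-P[X,PY]+P^2[X,Y]=0$$ for all (locally defined) vector fields $X,Y$. The characteristic polynomial of the pair at $x\in M$ is the characteristic polynomial of $P_x\colon T_xM\to T_xM$. A distribution (a locally trivial field $x\mapsto F_x\subseteq T_xM$ of subspaces, spanned near every point by a frame of vector fields) is called invariant if for every $x$ the subspace $F_x$ is preserved by every linear automorphism of $T_xM$ that preserves both forms $\omega_0$ and $\omega_1$. It is called integrable if through every point of $M$ there passes an immersed submanifold that is tangent to $F$ and has the dimension of $F$ (an integral manifold).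 Theorem. Let $M'$ and $M''$ be connected (non-empty) manifolds with pairs of compatible $2$-forms $(\omega_0',\omega_1')$ and $(\omega_0'',\omega_1'')$, and let $$(M,\omega_0,\omega_1)=(M',\omega_0',\omega_1')\times(M'',\omega_0'',\omega_1''),$$ that is, $M=M'\times M''$ and $\omega_i$ is the sum of the pull-backs of $\omega_i'$ and $\omega_i''$ under the two projections. Suppose that for all $x'\in M'$ and $x''\in M''$ the characteristic polynomial of $(\omega_0',\omega_1')$ at $x'$ and that of $(\omega_0'',\omega_1'')$ at $x''$ are coprime. Let $F$ be an invariant distribution on $M$. Then there are invariant distributions $F'$ on $M'$ and $F''$ on $M''$ such that $F$ is their direct product: $$F_{(x',x'')}=F'_{x'}\oplus F''_{x''}\subseteq T_{x'}M'\oplus T_{x''}M''=T_{(x',x'')}M\qquad\text{for all }x'\in M',\ x''\in M''.$$ Moreover, whenever $F$ is the direct product of distributions $F'$ on $M'$ and $F''$ on $M''$, the distribution $F$ is integrable if and only if both $F'$ and $F''$ are integrable. -/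

import Mathlib

open scoped Manifold ContDiff Bundle
open Set

namespace BiHam

noncomputable section

/-! ### Linear algebra -/

section Linear

variable {𝕜 : Type*} [Field 𝕜] {V : Type*} [AddCommGroup V] [Module 𝕜 V]

/-- A subspace `W` of `V` is invariant for a pair of bilinear maps `A`, `B` if it is preserved by
every linear automorphism of `V` that preserves both of them. -/
def IsInvariantSubspace (A B : V → V → 𝕜) (W : Submodule 𝕜 V) : Prop :=
  ∀ g : V ≃ₗ[𝕜] V, (∀ u v, A (g u) (g v) = A u v) → (∀ u v, B (g u) (g v) = B u v) →
    ∀ w ∈ W, g w ∈ W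

end Linear

section Pullback

variable {𝕜 : Type*} [RCLike 𝕜]
  {V : Type*} [TopologicalSpace V] [AddCommGroup V] [IsTopologicalAddGroup V] [Module 𝕜 V]
  [ContinuousConstSMul 𝕜 V]
  {W : Type*} [TopologicalSpace W] [AddCommGroup W] [IsTopologicalAddGroup W] [Module 𝕜 W]
  [ContinuousConstSMul 𝕜 W]

/-- The pull-back `(u, v) ↦ b (D u) (D v)` of a bilinear form under a linear map. -/
def pullbackBilin (b : V →L[𝕜] V →L[𝕜] 𝕜) (D : W →L[𝕜] V) : W →L[𝕜] W →L[𝕜] 𝕜 :=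
  (ContinuousLinearMap.precomp 𝕜 D).comp (b.comp D)

end Pullback

/-! ### Fields of 2-forms, compatible pairs, distributions -/

section Manifold

variable {𝕜 : Type*} [RCLike 𝕜]
  {E : Type*} [NormedAddCommGroup E] [NormedSpace 𝕜 E]
  {H : Type*} [TopologicalSpace H] (I : ModelWithCorners 𝕜 E H)
  (M : Type*) [TopologicalSpace M] [ChartedSpace H M]

/-- A field of bilinear forms on the tangent spaces of `M`. -/
abbrev BilinField : Type _ :=
  ∀ x : M, TangentSpace I x →L[𝕜] TangentSpace I x →L[𝕜] 𝕜

/-- A vector field on `M`. -/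
abbrev VField : Type _ := ∀ x : M, TangentSpace I x

variable {I M}

/-- `X` is of class `C^r` on the set `U`. -/
def VField.SmoothOn (r : ℕ∞ω) [IsManifold I 1 M] (X : VField I M) (U : Set M) : Prop :=
  ContMDiffOn I I.tangent r (fun x => (⟨x, X x⟩ : TangentBundle I M)) U

/-- `a` is of class `C^r`, as a section of the bundle of bilinear forms. -/
def BilinField.Smooth (r : ℕ∞ω) [IsManifold I 1 M] (a : BilinField I M) : Prop :=
  ContMDiff I (I.prod 𝓘(𝕜, E →L[𝕜] E →L[𝕜] 𝕜)) r
    (fun x => Bundle.TotalSpace.mk' (E →L[𝕜] E →L[𝕜] 𝕜)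
      (E := fun x : M => TangentSpace I x →L[𝕜] TangentSpace I x →L[𝕜] 𝕜) x (a x))

/-- The expression of `a` in the preferred chart at `x₀`: the pull-back of `a` under the inverse of
this chart. -/
def BilinField.inChart (a : BilinField I M) (x₀ : M) (y : E) : E →L[𝕜] E →L[𝕜] 𝕜 :=
  pullbackBilin (W := TangentSpace 𝓘(𝕜, E) y) (a ((extChartAt I x₀).symm y))
    (mfderivWithin 𝓘(𝕜, E) I (extChartAt I x₀).symm (range I) y)

/-- `da = 0`, for a field `a` of skew-symmetric forms. In a chart,
`da (u, v, w) = ∂_u a(v, w) + ∂_v a(w, u) + ∂_w a(u, v)` for constant vectors `u`, `v`, `w`. -/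
def BilinField.Closed (a : BilinField I M) : Prop :=
  ∀ x₀ : M, ∀ y ∈ (extChartAt I x₀).target, ∀ u v w : E,
    fderivWithin 𝕜 (a.inChart x₀) (range I) y u v w
      + fderivWithin 𝕜 (a.inChart x₀) (range I) y v w u
      + fderivWithin 𝕜 (a.inChart x₀) (range I) y w u v = 0

/-- The field of endomorphisms `P = ω₀⁻¹ ω₁`, that is, `ω₀ (P u, v) = ω₁ (u, v)`; the form `ω₀ x`
is read as the map `u ↦ ω₀ (u, ·)` from the tangent space to its dual. -/
def recursionOperator (ω₀ ω₁ : BilinField I M) (x : M) :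
    TangentSpace I x →L[𝕜] TangentSpace I x :=
  (ω₀ x).inverse.comp (ω₁ x)

/-- The Nijenhuis tensor of a field of endomorphisms `P` is zero:
`[PX, PY] - P [PX, Y] - P [X, PY] + P² [X, Y] = 0` for all locally defined vector fields
`X` and `Y` of class `C^r`. -/
def NijenhuisZero (r : ℕ∞ω) [IsManifold I 1 M]
    (P : ∀ x : M, TangentSpace I x →L[𝕜] TangentSpace I x) : Prop :=
  ∀ (U : Set M), IsOpen U → ∀ X Y : VField I M, X.SmoothOn r U → Y.SmoothOn r U → ∀ x ∈ U,
    VectorField.mlieBracket I (fun z => P z (X z)) (fun z => P z (Y z)) x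
      - P x (VectorField.mlieBracket I (fun z => P z (X z)) Y x)
      - P x (VectorField.mlieBracket I X (fun z => P z (Y z)) x)
      + P x (P x (VectorField.mlieBracket I X Y x)) = 0

/-- `(ω₀, ω₁)` is a pair of compatible 2-forms of class `C^r` on `M`. -/
structure IsCompatiblePair (r : ℕ∞ω) [IsManifold I 1 M] (ω₀ ω₁ : BilinField I M) : Prop where
  alternating₀ : ∀ x v, ω₀ x v v = 0
  alternating₁ : ∀ x v, ω₁ x v v = 0
  smooth₀ : ω₀.Smooth r
  smooth₁ : ω₁.Smooth r
  nondegenerate : ∀ x u, (∀ v, ω₀ x u v = 0) → u = 0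
  closed₀ : ω₀.Closed
  closed₁ : ω₁.Closed
  nijenhuis : NijenhuisZero r (recursionOperator ω₀ ω₁)

/-- The characteristic polynomial at `x` of the pair `(ω₀, ω₁)`, that is, of `P = ω₀⁻¹ ω₁`. -/
def charPolyAt [FiniteDimensional 𝕜 E] (ω₀ ω₁ : BilinField I M) (x : M) : Polynomial 𝕜 :=
  haveI : FiniteDimensional 𝕜 (TangentSpace I x) := inferInstanceAs (FiniteDimensional 𝕜 E)
  (recursionOperator ω₀ ω₁ x : TangentSpace I x →ₗ[𝕜] TangentSpace I x).charpoly

variable (I M) in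
/-- A distribution of class `C^r` on `M`: a field of tangent subspaces that is spanned, near every
point, by a frame of vector fields of class `C^r`. -/
structure Distribution (r : ℕ∞ω) [IsManifold I 1 M] where
  /-- The subspace at a point. -/
  fiber : ∀ x : M, Submodule 𝕜 (TangentSpace I x)
  exists_frame : ∀ x₀ : M, ∃ U : Set M, IsOpen U ∧ x₀ ∈ U ∧
    ∃ (k : ℕ) (X : Fin k → VField I M), (∀ i, (X i).SmoothOn r U) ∧
      ∀ x ∈ U, LinearIndependent 𝕜 (fun i => X i x) ∧
        Submodule.span 𝕜 (range fun i => X i x) = fiber x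

/-- Invariant distributions of a pair of 2-forms. -/
def Distribution.IsInvariant {r : ℕ∞ω} [IsManifold I 1 M] (F : Distribution I M r)
    (ω₀ ω₁ : BilinField I M) : Prop :=
  ∀ x, IsInvariantSubspace (fun u v => ω₀ x u v) (fun u v => ω₁ x u v) (F.fiber x)

/-- A distribution is integrable if through every point `x₀` there passes an integral manifold: an
immersed `C^r` submanifold, given by a parametrization `γ`, whose tangent space at each of its
points is the subspace of the distribution at that point. -/
def Distribution.IsIntegrable {r : ℕ∞ω} [IsManifold I 1 M] (F : Distribution I M r) : Prop :=
  ∀ x₀ : M, ∃ (k : ℕ) (U : Set (Fin k → 𝕜)) (γ : (Fin k → 𝕜) → M),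
    IsOpen U ∧ 0 ∈ U ∧ γ 0 = x₀ ∧ ContMDiffOn 𝓘(𝕜, Fin k → 𝕜) I r γ U ∧
    ∀ t ∈ U, Function.Injective (mfderiv 𝓘(𝕜, Fin k → 𝕜) I γ t) ∧
      ∀ v : TangentSpace I (γ t),
        v ∈ F.fiber (γ t) ↔ ∃ s, mfderiv 𝓘(𝕜, Fin k → 𝕜) I γ t s = v

end Manifold

/-! ### Direct products -/

section Product

variable {𝕜 : Type*} [RCLike 𝕜]
  {E₁ : Type*} [NormedAddCommGroup E₁] [NormedSpace 𝕜 E₁]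
  {H₁ : Type*} [TopologicalSpace H₁] {I₁ : ModelWithCorners 𝕜 E₁ H₁}
  {M₁ : Type*} [TopologicalSpace M₁] [ChartedSpace H₁ M₁]
  {E₂ : Type*} [NormedAddCommGroup E₂] [NormedSpace 𝕜 E₂]
  {H₂ : Type*} [TopologicalSpace H₂] {I₂ : ModelWithCorners 𝕜 E₂ H₂}
  {M₂ : Type*} [TopologicalSpace M₂] [ChartedSpace H₂ M₂]

/-- The form `pr₁^* ω₁ + pr₂^* ω₂` on `M₁ × M₂`. -/
def BilinField.prod (ω₁ : BilinField I₁ M₁) (ω₂ : BilinField I₂ M₂) :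
    BilinField (I₁.prod I₂) (M₁ × M₂) := fun x =>
  pullbackBilin (ω₁ x.1) (mfderiv (I₁.prod I₂) I₁ Prod.fst x)
    + pullbackBilin (ω₂ x.2) (mfderiv (I₁.prod I₂) I₂ Prod.snd x)

/-- `F` is the direct product of the distributions `F₁` and `F₂`: at `(x₁, x₂)` it consists of the
tangent vectors whose projections lie in `F₁` at `x₁` and in `F₂` at `x₂`. -/
def Distribution.IsProd {r : ℕ∞ω} [IsManifold I₁ 1 M₁] [IsManifold I₂ 1 M₂]
    (F : Distribution (I₁.prod I₂) (M₁ × M₂) r)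
    (F₁ : Distribution I₁ M₁ r) (F₂ : Distribution I₂ M₂ r) : Prop :=
  ∀ (x : M₁ × M₂) (v : TangentSpace (I₁.prod I₂) x),
    v ∈ F.fiber x ↔ mfderiv (I₁.prod I₂) I₁ Prod.fst x v ∈ F₁.fiber x.1 ∧
      mfderiv (I₁.prod I₂) I₂ Prod.snd x v ∈ F₂.fiber x.2

end Product

end

end BiHam

/-! The heart of the matter is linear algebra: a non-degenerate alternating form $A$ together with
an alternating form $B$, on a finite-dimensional space over an infinite field with $2 \neq 0$, has
only finitely many invariant subspaces. Put $P = A^{-1}B$; it is self-adjoint for $A$. Let $m$ be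
its minimal polynomial. A vector $u$ with annihilator $(m)$ and a suitable dual vector $v$ span over
$K[P]$ a non-degenerate plane $H$, free of rank 2 over $K[X]/(m)$, on which $SL_2(K[X])$ acts by
isometries commuting with $P$. The action forces an invariant $W$ to be $(W \cap H) \oplus (W \cap
H^\perp)$ with $W \cap H = Iu + Iv$ for an ideal $I \ni m$. There are finitely many such ideals, and
$H^\perp$ is handled by induction on the dimension (`finite_setOf_isIsometryInvariant_of_finrank`).

On the product, the automorphism $(\mathrm{id}, -\mathrm{id})$ shows that an invariant $F$ is at
each point the sum of its two projections. For fixed $x'$, the projection of $F_{(x', s)}$ to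
$T_{x'}M'$ is an invariant subspace depending continuously on $s \in M''$. Having finitely many
possible values, it is locally constant, hence constant because $M''$ is connected
(`Distribution.IsInvariant.fstFiber_eq`). The same holds for the other factor, and restricting to
slices gives smooth $F'$ and $F''$.

For integrability, the product of integral manifolds of $F'$ and $F''$ is one of $F$. Conversely, an
integral manifold of $F$, cut by a transversal to the kernel of the projection, is mapped onto an
integral manifold of the factor (`Distribution.IsIntegrable.of_map`). -/

namespace BiHam

open Polynomial

/-! ### Finiteness of the set of invariant subspaces -/

section InvariantSubspaces

variable {K : Type*} [Field K] {V : Type*} [AddCommGroup V] [Module K V]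

/-- `W` is preserved by all automorphisms of the form `A` that commute with `P`. -/
def IsIsometryInvariant (A : V →ₗ[K] V →ₗ[K] K) (P : Module.End K V) (W : Submodule K V) : Prop :=
  ∀ g : V ≃ₗ[K] V, (∀ u v, A (g u) (g v) = A u v) → (∀ u, g (P u) = P (g u)) → ∀ w ∈ W, g w ∈ W

/-- Such ideals are the divisors of $(m)$, and unique factorization of ideals leaves only finitely
many. -/
theorem finite_setOf_mem_ideal {R : Type*} [CommRing R] [IsDomain R] [IsPrincipalIdealRing R]
    {m : R} (hm : m ≠ 0) : {I : Ideal R | m ∈ I}.Finite := by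
  have h : Ideal.span {m} ≠ 0 := by simpa using hm
  have := UniqueFactorizationMonoid.fintypeSubtypeDvd (Ideal.span {m}) h
  refine (Set.finite_range (Subtype.val : {I // I ∣ Ideal.span {m}} → Ideal R)).subset
    fun I hI => ⟨⟨I, Ideal.dvd_span_singleton.2 hI⟩, rfl⟩

/-- Over an infinite field, some vector has the minimal polynomial of the endomorphism as its
annihilator. -/
theorem exists_minpoly_dvd_of_aeval_apply_eq_zero [Infinite K] [FiniteDimensional K V]
    (P : Module.End K V) :
    ∃ u : V, ∀ p : K[X], aeval P p u = 0 → minpoly K P ∣ p := by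
  classical
  set m := minpoly K P with hm
  have hm0 : m ≠ 0 := minpoly.ne_zero (Algebra.IsIntegral.isIntegral P)
  -- A vector whose annihilator is a proper divisor of $m$ is killed by $(m/q)(P)$ for some prime
  -- factor $q$ of $m$. These kernels are proper by minimality of $m$, and over an infinite field
  -- finitely many proper subspaces do not cover $V$.
  let s : Finset (Submodule K V) :=
    (UniqueFactorizationMonoid.normalizedFactors m).toFinset.image
      fun q => LinearMap.ker (aeval P (m / q))
  have hs : ⊤ ∉ s := by
    intro h
    obtain ⟨q, hq, hker⟩ := Finset.mem_image.1 h
    rw [Multiset.mem_toFinset] at hq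
    have hqm := UniqueFactorizationMonoid.dvd_of_mem_normalizedFactors hq
    have hqi := UniqueFactorizationMonoid.irreducible_of_normalized_factor q hq
    have h0 : aeval P (m / q) = 0 := LinearMap.ker_eq_top.1 hker
    have h1 : m ∣ m / q := minpoly.dvd K P h0
    have h2 : q * (m / q) = m := EuclideanDomain.mul_div_cancel' hqi.ne_zero hqm
    have h3 : m / q ≠ 0 := fun h => hm0 (by rw [← h2, h, mul_zero])
    obtain ⟨c, hc⟩ := h1
    apply hqi.not_isUnit
    refine IsUnit.of_mul_eq_one c ?_
    apply mul_left_cancel₀ h3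
    calc m / q * (q * c) = q * (m / q) * c := by ring
      _ = m / q * 1 := by rw [h2, mul_one, ← hc]
  have hne := Subspace.biUnion_ne_univ_of_top_notMem hs
  obtain ⟨u, hu⟩ := (Set.ne_univ_iff_exists_notMem _).1 hne
  refine ⟨u, fun p hp => ?_⟩
  let d := gcd p m
  have hd : aeval P d u = 0 := by
    obtain ⟨a, b, hab⟩ := exists_gcd_eq_mul_add_mul p m
    have : d = a * p + b * m := by rw [mul_comm a, mul_comm b]; exact hab
    rw [this]
    simp [hp, hm, minpoly.aeval]
  have hdm : d ∣ m := gcd_dvd_right p m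
  obtain ⟨c, hc⟩ := hdm
  by_cases hcu : IsUnit c
  · have : m ∣ d := by
      rw [hc]
      exact (hcu.mul_right_dvd).2 dvd_rfl
    exact this.trans (gcd_dvd_left p m)
  · exfalso
    have hc0 : c ≠ 0 := fun h => hm0 (by rw [hc, h, mul_zero])
    obtain ⟨q, hqi, hqc⟩ := WfDvdMonoid.exists_irreducible_factor hcu hc0
    obtain ⟨q', hq', hass⟩ := UniqueFactorizationMonoid.exists_mem_normalizedFactors_of_dvd hm0 hqi
      (hqc.trans (Dvd.intro_left d hc.symm))
    apply hu
    simp only [Set.mem_iUnion]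
    refine ⟨LinearMap.ker (aeval P (m / q')), Finset.mem_image.2
      ⟨q', Multiset.mem_toFinset.2 hq', rfl⟩, ?_⟩
    obtain ⟨e, he⟩ := hass.symm.dvd.trans hqc
    have hq0 : q' ≠ 0 := fun h => hc0 (by rw [he, h, zero_mul])
    have : m / q' = e * d := by
      rw [hc, he, show d * (q' * e) = q' * (e * d) by ring, mul_div_cancel_left₀ _ hq0]
    simp [this, hd]

/-- A trace form on `K[X] / (m)`. -/
noncomputable def topCoeff (m : K[X]) : K[X] →ₗ[K] K :=
  lcoeff K (m.natDegree - 1) ∘ₗ modByMonicHom m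

theorem topCoeff_eq_zero_of_dvd {m : K[X]} (hm : m.Monic) {p : K[X]} (h : m ∣ p) :
    topCoeff m p = 0 := by
  simp [topCoeff, modByMonicHom, (modByMonic_eq_zero_iff_dvd hm).2 h]

/-- A nonzero remainder of $p$ modulo $m$ can be multiplied by a power of $X$ to reach degree
exactly $\deg m - 1$; its leading coefficient is then detected. Hence $(p, t) \mapsto$ `topCoeff m
(p * t)` is a non-degenerate form on $K[X]/(m)$. -/
theorem dvd_of_topCoeff_mul_eq_zero {m : K[X]} (hm : m.Monic) {p : K[X]}
    (h : ∀ t, topCoeff m (p * t) = 0) : m ∣ p := by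
  by_contra hp
  set r := p %ₘ m with hr
  have hr0 : r ≠ 0 := fun h0 => hp ((modByMonic_eq_zero_iff_dvd hm).1 h0)
  have hdeg : r.degree < m.degree := degree_modByMonic_lt p hm
  have hnat : r.natDegree < m.natDegree := natDegree_lt_natDegree hr0 hdeg
  have h1 := h (X ^ (m.natDegree - 1 - r.natDegree))
  have h2 : (p * X ^ (m.natDegree - 1 - r.natDegree)) %ₘ m
      = r * X ^ (m.natDegree - 1 - r.natDegree) := by
    have h3 : (r * X ^ (m.natDegree - 1 - r.natDegree)) %ₘ m
        = r * X ^ (m.natDegree - 1 - r.natDegree) := by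
      rw [modByMonic_eq_self_iff hm]
      rw [degree_eq_natDegree (mul_ne_zero hr0 (by simp)), degree_eq_natDegree hm.ne_zero,
        natDegree_mul_X_pow _ hr0]
      exact_mod_cast (by omega)
    rw [← h3, ← sub_eq_zero, ← sub_modByMonic, modByMonic_eq_zero_iff_dvd hm, ← sub_mul]
    refine Dvd.dvd.mul_right ?_ _
    rw [← modByMonic_eq_zero_iff_dvd hm, sub_modByMonic, (modByMonic_eq_self_iff hm).2 hdeg, hr,
      sub_self]
  simp only [topCoeff, LinearMap.comp_apply, modByMonicHom, LinearMap.coe_mk, AddHom.coe_mk,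
    lcoeff_apply, h2] at h1
  rw [show m.natDegree - 1 = r.natDegree + (m.natDegree - 1 - r.natDegree) by omega,
    show r.natDegree + (m.natDegree - 1 - r.natDegree) - r.natDegree
      = (m.natDegree - 1 - r.natDegree) by omega, coeff_mul_X_pow] at h1
  exact hr0 (leadingCoeff_eq_zero.1 h1)

/-! ### Self-adjoint operators on a symplectic space -/

section

variable {A : V →ₗ[K] V →ₗ[K] K} {P : Module.End K V}

theorem apply_aeval_comm (hsa : ∀ u v, A (P u) v = A u (P v)) (p : K[X]) :
    ∀ u v, A (aeval P p u) v = A u (aeval P p v) := by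
  induction p using Polynomial.induction_on with
  | C a => intro u v; simp [Module.algebraMap_end_apply]
  | add p q hp hq => intro u v; simp [hp, hq]
  | monomial n a h =>
    intro u v
    rw [pow_succ, ← mul_assoc, map_mul]
    simp only [Module.End.mul_apply, aeval_X, h, hsa]
    rw [← Module.End.mul_apply, ← Module.End.mul_apply]
    congr 2
    have := ((Commute.all (C a * X ^ n) (X : K[X])).map (aeval P)).symm.eq
    rwa [aeval_X] at this

theorem apply_neg_of_alternating (halt : ∀ v, A v v = 0) (u v : V) : A u v = -A v u := by
  have := halt (u + v)
  simp only [map_add, LinearMap.add_apply, halt, zero_add, add_zero] at this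
  exact eq_neg_of_add_eq_zero_right this

/-- Self-adjointness and skew-symmetry give the value opposite signs. Consequently each cyclic
subspace $K[P]u$ is isotropic. -/
theorem apply_aeval_self (h2 : (2 : K) ≠ 0) (halt : ∀ v, A v v = 0)
    (hsa : ∀ u v, A (P u) v = A u (P v)) (p : K[X]) (u : V) : A (aeval P p u) u = 0 := by
  have h := apply_neg_of_alternating halt (aeval P p u) u
  rw [← apply_aeval_comm hsa, eq_neg_iff_add_eq_zero, ← two_mul] at h
  exact (mul_eq_zero.1 h).resolve_left h2

/-- In a symplectic space with a self-adjoint operator of minimal polynomial `m`, two vectors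
generate a hyperbolic plane over `K[X] / (m)`. -/
theorem exists_hyperbolic_pair [Infinite K] [FiniteDimensional K V]
    (hnd : ∀ u, (∀ v, A u v = 0) → u = 0) (halt : ∀ v, A v v = 0) :
    ∃ u v : V, ∀ p : K[X], A (aeval P p u) v = topCoeff (minpoly K P) p := by
  obtain ⟨u, hu⟩ := exists_minpoly_dvd_of_aeval_apply_eq_zero P
  have hmon := minpoly.monic (Algebra.IsIntegral.isIntegral (R := K) P)
  let φ : K[X] →ₗ[K] V := (LinearMap.applyₗ u) ∘ₗ (aeval P).toLinearMap
  have hφ : ∀ p, φ p = aeval P p u := fun p => rfl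
  -- By the choice of $u$, `topCoeff` vanishes on the annihilator of $u$, so $p(P)u \mapsto$
  -- `topCoeff m p` is well defined and extends to a functional on $V$. The vector $v$ represents it
  -- through $A$.
  have hker : topCoeff (minpoly K P) ∈ (LinearMap.ker φ).dualAnnihilator := by
    rw [Submodule.mem_dualAnnihilator]
    intro p hp
    exact topCoeff_eq_zero_of_dvd hmon (hu p hp)
  rw [← LinearMap.range_dualMap_eq_dualAnnihilator_ker] at hker
  obtain ⟨f, hf⟩ := hker
  have hinj : Function.Injective A.flip := by
    rw [injective_iff_map_eq_zero]
    intro v hv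
    refine hnd v fun w => ?_
    rw [apply_neg_of_alternating halt, ← LinearMap.flip_apply, hv]
    simp
  have hsurj : Function.Surjective (A.flip : V →ₗ[K] Module.Dual K V) :=
    (LinearMap.injective_iff_surjective_of_finrank_eq_finrank
      Subspace.dual_finrank_eq.symm).1 hinj
  obtain ⟨v, hv⟩ := hsurj f
  refine ⟨u, v, fun p => ?_⟩
  rw [← hf, ← LinearMap.flip_apply, hv]
  rfl

/-- An isometry of an orthogonal direct sum from isometries of the summands. -/
theorem exists_isometry_of_isCompl {H N : Submodule K V} (hc : IsCompl H N)
    (hHN : ∀ x ∈ H, ∀ y ∈ N, A x y = 0) (halt : ∀ v, A v v = 0)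
    (hPH : ∀ x ∈ H, P x ∈ H) (hPN : ∀ x ∈ N, P x ∈ N)
    (gH : H ≃ₗ[K] H) (gN : N ≃ₗ[K] N)
    (hAH : ∀ x y : H, A (gH x) (gH y) = A x y) (hAN : ∀ x y : N, A (gN x) (gN y) = A x y)
    (hH : ∀ x : H, (gH ⟨P x, hPH x x.2⟩ : V) = P (gH x))
    (hN : ∀ x : N, (gN ⟨P x, hPN x x.2⟩ : V) = P (gN x)) :
    ∃ g : V ≃ₗ[K] V, (∀ u v, A (g u) (g v) = A u v) ∧ (∀ u, g (P u) = P (g u)) ∧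
      (∀ x : H, g x = gH x) ∧ ∀ x : N, g x = gN x := by
  let e := Submodule.prodEquivOfIsCompl H N hc
  let g : V ≃ₗ[K] V := (e.symm ≪≫ₗ gH.prodCongr gN) ≪≫ₗ e
  have hg : ∀ (x : H) (y : N), g (x + y) = gH x + gN y := by
    intro x y
    have : (x + y : V) = e (x, y) := by simp [e]
    rw [this]
    simp [g, e]
  have hNH : ∀ x ∈ H, ∀ y ∈ N, A y x = 0 := fun x hx y hy => by
    rw [apply_neg_of_alternating halt, hHN x hx y hy, neg_zero]
  have hdec : ∀ u : V, ∃ (x : H) (y : N), u = x + y := by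
    intro u
    refine ⟨(e.symm u).1, (e.symm u).2, ?_⟩
    conv_lhs => rw [← e.apply_symm_apply u]
    simp [e]
  refine ⟨g, fun u v => ?_, fun u => ?_, fun x => by simpa using hg x 0, fun x => by
    simpa using hg 0 x⟩
  · obtain ⟨x, y, rfl⟩ := hdec u
    obtain ⟨z, w, rfl⟩ := hdec v
    rw [hg, hg]
    simp only [map_add, LinearMap.add_apply, hAH, hAN]
    rw [hHN _ (gH x).2 _ (gN w).2, hNH _ (gH z).2 _ (gN y).2, hHN _ x.2 _ w.2, hNH _ z.2 _ y.2]
  · obtain ⟨x, y, rfl⟩ := hdec u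
    rw [hg, map_add, map_add P, ← hH, ← hN]
    exact hg ⟨P x, hPH x x.2⟩ ⟨P y, hPN y y.2⟩

end

/-! ### The plane spanned by two vectors over $K[P]$ and its matrix action -/

section

variable (P : Module.End K V) (u v : V)

/-- The map `(p, q) ↦ p(P) u + q(P) v`. -/
noncomputable def planeMap : K[X] × K[X] →ₗ[K] V :=
  ((LinearMap.applyₗ u) ∘ₗ (aeval P).toLinearMap).coprod
    ((LinearMap.applyₗ v) ∘ₗ (aeval P).toLinearMap)

theorem planeMap_apply (z : K[X] × K[X]) :
    planeMap P u v z = aeval P z.1 u + aeval P z.2 v := rfl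

theorem apply_planeMap (z : K[X] × K[X]) :
    P (planeMap P u v z) = planeMap P u v (X * z.1, X * z.2) := by
  simp [planeMap_apply]

/-- The action of the matrix `!![a, b; c, d]` on `K[X] × K[X]`. -/
noncomputable def matMap (a b c d : K[X]) : K[X] × K[X] →ₗ[K] K[X] × K[X] :=
  ((LinearMap.mulLeft K a).coprod (LinearMap.mulLeft K b)).prod
    ((LinearMap.mulLeft K c).coprod (LinearMap.mulLeft K d))

theorem matMap_apply (a b c d : K[X]) (z : K[X] × K[X]) :
    matMap a b c d z = (a * z.1 + b * z.2, c * z.1 + d * z.2) := rfl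

variable {P u v}

/-- The kernel of `planeMap` is $(m) \times (m)$, which every polynomial matrix preserves, so the
matrix descends to the plane. -/
theorem exists_plane_endomorphism (hker : ∀ z, planeMap P u v z = 0 ↔
      minpoly K P ∣ z.1 ∧ minpoly K P ∣ z.2) (a b c d : K[X]) :
    ∃ g : LinearMap.range (planeMap P u v) →ₗ[K] LinearMap.range (planeMap P u v),
      ∀ z, g ((planeMap P u v).rangeRestrict z)
        = (planeMap P u v).rangeRestrict (matMap a b c d z) := by
  set h := planeMap P u v
  have hle : LinearMap.ker h ≤ LinearMap.ker (h.rangeRestrict ∘ₗ matMap a b c d) := by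
    intro z hz
    have hz' := (hker z).1 hz
    rw [LinearMap.mem_ker, LinearMap.comp_apply]
    refine Subtype.ext ?_
    exact (hker _).2 ⟨(hz'.1.mul_left a).add (hz'.2.mul_left b),
      (hz'.1.mul_left c).add (hz'.2.mul_left d)⟩
  refine ⟨(LinearMap.ker h).liftQ _ hle ∘ₗ h.quotKerEquivRange.symm.toLinearMap, fun z => ?_⟩
  have : h.quotKerEquivRange.symm (h.rangeRestrict z) = (LinearMap.ker h).mkQ z := by
    rw [LinearEquiv.symm_apply_eq]
    rfl
  rw [LinearMap.comp_apply, LinearEquiv.coe_coe, this, Submodule.mkQ_apply, Submodule.liftQ_apply]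
  rfl

/-- The inverse comes from the adjugate matrix. -/
theorem exists_plane_equiv (hker : ∀ z, planeMap P u v z = 0 ↔
      minpoly K P ∣ z.1 ∧ minpoly K P ∣ z.2) {a b c d : K[X]} (hdet : a * d - b * c = 1) :
    ∃ g : LinearMap.range (planeMap P u v) ≃ₗ[K] LinearMap.range (planeMap P u v),
      ∀ z, g ((planeMap P u v).rangeRestrict z)
        = (planeMap P u v).rangeRestrict (matMap a b c d z) := by
  obtain ⟨g, hg⟩ := exists_plane_endomorphism hker a b c d
  obtain ⟨g', hg'⟩ := exists_plane_endomorphism hker d (-b) (-c) a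
  refine ⟨LinearEquiv.ofLinearMap g g' ?_ ?_, hg⟩
  · ext1 x
    obtain ⟨z, rfl⟩ := LinearMap.surjective_rangeRestrict _ x
    rw [LinearMap.comp_apply, hg', hg, LinearMap.id_apply]
    congr 1
    ext1 <;> simp only [matMap_apply]
    · linear_combination z.1 * hdet
    · linear_combination z.2 * hdet
  · ext1 x
    obtain ⟨z, rfl⟩ := LinearMap.surjective_rangeRestrict _ x
    rw [LinearMap.comp_apply, hg, hg', LinearMap.id_apply]
    congr 1
    ext1 <;> simp only [matMap_apply]
    · linear_combination z.1 * hdet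
    · linear_combination z.2 * hdet

end

set_option maxHeartbeats 1000000 in
-- Strong induction on the dimension: split off the hyperbolic plane $H$. An invariant $W$ is
-- determined by the ideal of those $p$ with $p(P)u \in W$ and by its trace on $N = H^\perp$.
theorem finite_setOf_isIsometryInvariant_of_finrank [Infinite K] (h2 : (2 : K) ≠ 0) (n : ℕ) :
    ∀ {V : Type*} [AddCommGroup V] [Module K V] [FiniteDimensional K V]
      (A : V →ₗ[K] V →ₗ[K] K) (P : Module.End K V), Module.finrank K V = n →
      (∀ u, (∀ v, A u v = 0) → u = 0) → (∀ v, A v v = 0) → (∀ u v, A (P u) v = A u (P v)) →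
      {W | IsIsometryInvariant A P W}.Finite := by
  induction n using Nat.strong_induction_on with
  | _ n ih =>
  intro V _ _ _ A P hn hnd halt hsa
  rcases subsingleton_or_nontrivial V with hV | hV
  · exact Set.toFinite _
  have hmon := minpoly.monic (Algebra.IsIntegral.isIntegral (R := K) P)
  obtain ⟨u, v, huv⟩ := exists_hyperbolic_pair (P := P) hnd halt
  have hmin : ∀ p, minpoly K P ∣ p → aeval P p = 0 := fun p hp =>
    (minpoly.dvd_iff).1 hp
  set m := minpoly K P with hm
  set h := planeMap P u v with hh
  -- the form on the plane
  have hAh : ∀ z w, A (h z) (h w) = topCoeff m (z.1 * w.2 - z.2 * w.1) := by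
    intro z w
    have huu : ∀ p q, A (aeval P p u) (aeval P q u) = 0 := fun p q => by
      rw [← apply_aeval_comm hsa, ← Module.End.mul_apply, ← map_mul, apply_aeval_self h2 halt hsa]
    have hvv : ∀ p q, A (aeval P p v) (aeval P q v) = 0 := fun p q => by
      rw [← apply_aeval_comm hsa, ← Module.End.mul_apply, ← map_mul, apply_aeval_self h2 halt hsa]
    have huv' : ∀ p q, A (aeval P p u) (aeval P q v) = topCoeff m (p * q) := fun p q => by
      rw [← apply_aeval_comm hsa, ← Module.End.mul_apply, ← map_mul, huv, mul_comm]
    rw [hh, planeMap_apply, planeMap_apply]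
    simp only [map_add, LinearMap.add_apply, huu, hvv, huv']
    rw [apply_neg_of_alternating halt (aeval P z.2 v), huv', map_sub, mul_comm w.1]
    ring
  -- Pairing with $t(P)v$ and $t(P)u$ isolates each coordinate; non-degeneracy of the trace form
  -- then makes $H$ free of rank 2 over $K[X]/(m)$.
  have hker : ∀ z, h z = 0 ↔ m ∣ z.1 ∧ m ∣ z.2 := by
    refine fun z => ⟨fun hz => ⟨?_, ?_⟩, fun hz => ?_⟩
    · refine dvd_of_topCoeff_mul_eq_zero hmon fun t => ?_
      have := hAh z (0, t)
      simpa [hz] using this.symm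
    · refine dvd_of_topCoeff_mul_eq_zero hmon fun t => ?_
      have := hAh z (t, 0)
      simpa [hz] using this.symm
    · rw [hh, planeMap_apply, hmin _ hz.1, hmin _ hz.2]
      simp
  have hAnd : ∀ z, (∀ w, A (h z) (h w) = 0) → h z = 0 := fun z hz => by
    rw [hker]
    constructor
    · refine dvd_of_topCoeff_mul_eq_zero hmon fun t => ?_
      simpa [hAh] using hz (0, t)
    · refine dvd_of_topCoeff_mul_eq_zero hmon fun t => ?_
      simpa [hAh] using hz (t, 0)
  set H := LinearMap.range h with hH
  let N : Submodule K V := LinearMap.BilinForm.orthogonal A H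
  have hrefl : LinearMap.BilinForm.IsRefl A := fun x y hxy => by
    rw [apply_neg_of_alternating halt, hxy, neg_zero]
  have hc : IsCompl H N := by
    refine LinearMap.BilinForm.isCompl_orthogonal_of_restrict_nondegenerate hrefl ?_
    refine (LinearMap.IsRefl.nondegenerate_iff_separatingLeft
      (B := LinearMap.BilinForm.restrict A H) fun x y hxy => hrefl x y hxy).2 ?_
    rintro ⟨_, z, rfl⟩ hz
    exact Subtype.ext (hAnd z fun w => hz ⟨h w, w, rfl⟩)
  have hHN : ∀ x ∈ H, ∀ y ∈ N, A x y = 0 := fun x hx y hy => hy x hx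
  have hPH : ∀ x ∈ H, P x ∈ H := by
    rintro _ ⟨z, rfl⟩
    rw [apply_planeMap]
    exact ⟨_, rfl⟩
  have hPN : ∀ x ∈ N, P x ∈ N := fun y hy x hx => by
    change A x (P y) = 0
    rw [← hsa]
    exact hy _ (hPH x hx)
  -- the action of `SL₂` on the plane
  have hact : ∀ W, IsIsometryInvariant A P W → ∀ a b c d : K[X], a * d - b * c = 1 →
      (∀ z, h z ∈ W → h (a * z.1 + b * z.2, c * z.1 + d * z.2) ∈ W) ∧
      ∀ z, ∀ y ∈ N, h z + y ∈ W → h (a * z.1 + b * z.2, c * z.1 + d * z.2) + y ∈ W := by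
    intro W hW a b c d hdet
    obtain ⟨gH, hgH⟩ := exists_plane_equiv hker hdet
    have hgH' : ∀ z, (gH ⟨h z, z, rfl⟩ : V) = h (matMap a b c d z) := fun z =>
      congrArg Subtype.val (hgH z)
    obtain ⟨g, hg1, hg2, hg3, hg4⟩ := exists_isometry_of_isCompl (P := P) hc hHN halt hPH hPN gH
      (LinearEquiv.refl K N) (by
        rintro ⟨_, z, rfl⟩ ⟨_, w, rfl⟩
        rw [hgH', hgH', hAh, hAh]
        congr 1
        simp only [matMap_apply]
        linear_combination (z.1 * w.2 - z.2 * w.1) * hdet) (fun _ _ => rfl) (by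
        rintro ⟨_, z, rfl⟩
        have := hgH' (X * z.1, X * z.2)
        simp only [hh, apply_planeMap] at this ⊢
        simp only [hh] at hgH'
        rw [this, hgH', apply_planeMap]
        congr 1
        simp only [matMap_apply]
        ext1 <;> simp only <;> ring) (fun _ => rfl)
    have hgz : ∀ z, g (h z) = h (a * z.1 + b * z.2, c * z.1 + d * z.2) := fun z =>
      (hg3 ⟨h z, z, rfl⟩).trans (hgH' z)
    refine ⟨fun z hz => ?_, fun z y hy hz => ?_⟩
    · rw [← hgz]
      exact hW g hg1 hg2 _ hz
    · have := hW g hg1 hg2 _ hz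
      rwa [map_add, hgz, hg4 ⟨y, hy⟩] at this
  have hsplit : ∀ W, IsIsometryInvariant A P W → ∀ z, ∀ y ∈ N, h z + y ∈ W → h z ∈ W ∧ y ∈ W := by
    intro W hW z y hy hz
    -- The matrix $-1$ negates the component in $H$ and fixes the one in $N$; the difference
    -- isolates twice the component in $H$.
    have h1 := (hact W hW (-1) 0 0 (-1) (by ring)).2 z y hy hz
    have h3 : h (-1 * z.1 + 0 * z.2, 0 * z.1 + -1 * z.2) = - h z := by
      rw [← map_neg]
      congr 1
      ext1 <;> simp
    rw [h3] at h1
    have h4 : h z ∈ W := by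
      have := W.smul_mem (2 : K)⁻¹ (W.sub_mem hz h1)
      rwa [show h z + y - (-h z + y) = (2 : K) • h z by rw [two_smul]; abel, smul_smul,
        inv_mul_cancel₀ h2, one_smul] at this
    exact ⟨h4, by simpa using W.sub_mem hz h4⟩
  -- A shear minus the identity sends $(p, q)$ to $(q, 0)$, and the rotation sends $(p, q)$ to $(q,
  -- -p)$. So both coordinates are subject to the same membership condition.
  have hmem : ∀ W, IsIsometryInvariant A P W → ∀ z, h z ∈ W ↔ h (z.1, 0) ∈ W ∧ h (z.2, 0) ∈ W := by
    intro W hW z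
    have hswap : ∀ z, h z ∈ W → h (z.2, -z.1) ∈ W := fun z hz => by
      simpa using (hact W hW 0 1 (-1) 0 (by ring)).1 z hz
    have hshear : ∀ z, h z ∈ W → h (z.2, 0) ∈ W := fun z hz => by
      have h1 := (hact W hW 1 1 0 1 (by ring)).1 z hz
      have h3 := W.sub_mem h1 hz
      rw [← map_sub] at h3
      have h4 : (1 * z.1 + 1 * z.2, 0 * z.1 + 1 * z.2) - z = (z.2, 0) := by ext1 <;> simp
      rwa [h4] at h3
    constructor
    · intro hz
      refine ⟨?_, hshear z hz⟩
      have := W.neg_mem (hshear _ (hswap z hz))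
      rw [← map_neg] at this
      simpa using this
    · rintro ⟨h3, h4⟩
      have h5 := W.neg_mem (hswap _ h4)
      rw [← map_neg] at h5
      have := W.add_mem h3 h5
      rw [← map_add] at this
      simpa using this
  have hideal : ∀ W, IsIsometryInvariant A P W → ∃ I : Ideal K[X], m ∈ I ∧
      (I : Set K[X]) = {p | h (p, 0) ∈ W} := by
    intro W hW
    refine ⟨{ carrier := {p | h (p, 0) ∈ W}, add_mem' := ?_, zero_mem' := ?_, smul_mem' := ?_ },
      ?_, rfl⟩
    · intro p q hp hq
      have := W.add_mem hp hq
      rwa [← map_add, Prod.mk_add_mk, add_zero] at this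
    · change h 0 ∈ W
      simp
    · intro c p hp
      -- No stability of $W$ under $P$ is given, so multiplication by $c$ comes from a shear: $(0,
      -- p) \mapsto (cp, p)$.
      have hp' : h (0, p) ∈ W := (hmem W hW (0, p)).2 ⟨by change h 0 ∈ W; simp, hp⟩
      have := (hact W hW 1 c 0 1 (by ring)).1 _ hp'
      simpa using ((hmem W hW _).1 this).1
    · change h (m, 0) ∈ W
      have h0 : h (m, 0) = 0 := (hker (m, 0)).2 ⟨dvd_rfl, dvd_zero m⟩
      rw [h0]
      exact W.zero_mem
  -- the orthogonal complement
  let AN : N →ₗ[K] N →ₗ[K] K := A.domRestrict₁₂ N N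
  let PN : Module.End K N := P.restrict hPN
  have hANnd : ∀ x : N, (∀ y, AN x y = 0) → x = 0 := by
    intro x hx
    refine Subtype.ext (hnd x fun w => ?_)
    have hw : w ∈ H ⊔ N := by rw [hc.sup_eq_top]; trivial
    obtain ⟨y, hy, z, hz, rfl⟩ := Submodule.mem_sup.1 hw
    rw [map_add, apply_neg_of_alternating halt, hHN y hy x x.2, neg_zero, zero_add]
    exact hx ⟨z, hz⟩
  have hfin : Module.finrank K N < n := by
    rw [← hn]
    refine Submodule.finrank_lt fun htop => ?_
    -- The plane is nonzero: $u = 0$ would make $m$ a unit, impossible for nontrivial $V$.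
    have hbot : H = ⊥ := by
      have := hc.inf_eq_bot
      rwa [htop, inf_top_eq] at this
    have h1 : h (1, 0) ∈ H := ⟨_, rfl⟩
    rw [hbot, Submodule.mem_bot, hker] at h1
    exact minpoly.not_isUnit K P (isUnit_of_dvd_one h1.1)
  have hNfin := ih _ hfin AN PN rfl hANnd (fun x => halt x) (fun x y => hsa x y)
  have hJfin := (finite_setOf_mem_ideal hmon.ne_zero).image fun I : Ideal K[X] => (I : Set K[X])
  refine Set.Finite.of_injOn (f := fun W : Submodule K V =>
    (({p | h (p, 0) ∈ W} : Set K[X]), W.comap N.subtype)) ?_ ?_ (hJfin.prod hNfin)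
  · intro W hW
    refine ⟨?_, ?_⟩
    · obtain ⟨I, hI, hIW⟩ := hideal W hW
      exact ⟨I, hI, hIW⟩
    · intro gN hg1 hg2 x hx
      obtain ⟨g, h1, h2, -, h3⟩ := exists_isometry_of_isCompl (P := P) hc hHN halt hPH hPN
        (LinearEquiv.refl K H) gN (fun _ _ => rfl) (fun x y => hg1 x y) (fun _ => rfl)
        (fun x => congrArg Subtype.val (hg2 x))
      have := hW g h1 h2 _ hx
      rw [Submodule.subtype_apply, h3] at this
      exact this
  · intro W₁ hW₁ W₂ hW₂ heq
    simp only [Prod.mk.injEq] at heq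
    obtain ⟨he1, he2⟩ := heq
    have key : ∀ W₁ W₂, IsIsometryInvariant A P W₁ → IsIsometryInvariant A P W₂ →
        ({p | h (p, 0) ∈ W₁} : Set K[X]) = {p | h (p, 0) ∈ W₂} →
        W₁.comap N.subtype = W₂.comap N.subtype → W₁ ≤ W₂ := by
      intro W₁ W₂ hW₁ hW₂ he1 he2 x hx
      have hxs : x ∈ H ⊔ N := by rw [hc.sup_eq_top]; trivial
      obtain ⟨_, ⟨z, rfl⟩, y, hy, rfl⟩ := Submodule.mem_sup.1 hxs
      obtain ⟨hz, hy'⟩ := hsplit W₁ hW₁ z y hy hx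
      refine W₂.add_mem ?_ ?_
      · rw [hmem W₁ hW₁] at hz
        rw [hmem W₂ hW₂]
        exact ⟨(Set.ext_iff.1 he1 _).1 hz.1, (Set.ext_iff.1 he1 _).1 hz.2⟩
      · exact (SetLike.ext_iff.1 he2 ⟨y, hy⟩).1 hy'
    exact le_antisymm (key _ _ hW₁ hW₂ he1 he2) (key _ _ hW₂ hW₁ he1.symm he2.symm)

/-- A finite-dimensional space with a non-degenerate alternating form `A` and an alternating form
`B` has only finitely many invariant subspaces. -/
theorem finite_setOf_isInvariantSubspace [Infinite K] [FiniteDimensional K V] (h2 : (2 : K) ≠ 0)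
    (A B : V →ₗ[K] V →ₗ[K] K) (hnd : ∀ u, (∀ v, A u v = 0) → u = 0) (hA : ∀ v, A v v = 0)
    (hB : ∀ v, B v v = 0) :
    {W | IsInvariantSubspace (fun u v => A u v) (fun u v => B u v) W}.Finite := by
  have hinj : Function.Injective A := by
    rw [injective_iff_map_eq_zero]
    exact fun u hu => hnd u fun v => by rw [hu]; simp
  let e : V ≃ₗ[K] Module.Dual K V := LinearEquiv.ofInjectiveOfFinrankEq A hinj
    Subspace.dual_finrank_eq.symm
  let P : Module.End K V := e.symm.toLinearMap ∘ₗ B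
  have hP : ∀ u v, A (P u) v = B u v := fun u v =>
    LinearMap.congr_fun (e.apply_symm_apply (B u)) v
  refine (finite_setOf_isIsometryInvariant_of_finrank h2 _ A P rfl hnd hA fun u v => ?_).subset ?_
  -- $P = A^{-1}B$ is self-adjoint because both forms are skew. Below, an isometry of $A$ commuting
  -- with $P$ also preserves $B$.
  · rw [hP, apply_neg_of_alternating hB, ← hP, ← apply_neg_of_alternating hA]
  · intro W hW g hg1 hg2
    exact hW g hg1 fun u v => by
      change B (g u) (g v) = B u v
      rw [← hP, ← hP, ← hg2, hg1]

end InvariantSubspaces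

/-! ### Local frames -/

theorem exists_fin_linearIndependent_subfamily {K V ι : Type*} [DivisionRing K] [AddCommGroup V]
    [Module K V] [Finite ι] (v : ι → V) :
    ∃ (n : ℕ) (σ : Fin n → ι), LinearIndependent K (fun i => v (σ i)) ∧
      Submodule.span K (range fun i => v (σ i)) = Submodule.span K (range v) := by
  obtain ⟨κ, a, ha, hspan, hli⟩ := exists_linearIndependent' K v
  have : Finite κ := Finite.of_injective a ha
  obtain ⟨n, ⟨e⟩⟩ := Finite.exists_equiv_fin κ
  refine ⟨n, a ∘ e.symm, hli.comp _ e.symm.injective, ?_⟩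
  rw [← hspan]
  congr 1
  exact e.symm.surjective.range_comp (v ∘ a)

section Manifold

variable {𝕜 : Type*} [RCLike 𝕜]
  {E : Type*} [NormedAddCommGroup E] [NormedSpace 𝕜 E]
  {H : Type*} [TopologicalSpace H] {I : ModelWithCorners 𝕜 E H}
  {M : Type*} [TopologicalSpace M] [ChartedSpace H M]

theorem finiteDimensional_tangentSpace [FiniteDimensional 𝕜 E] (x : M) :
    FiniteDimensional 𝕜 (TangentSpace I x) :=
  inferInstanceAs (FiniteDimensional 𝕜 E)

/-- Linear independence of continuous vector fields along a map is an open condition. -/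
theorem eventually_linearIndependent [IsManifold I 1 M] {X : Type*} [TopologicalSpace X]
    {f : X → M} {ι : Type*} [Finite ι] {v : ι → ∀ x, TangentSpace I (f x)} {x₀ : X}
    (hf : ContinuousAt f x₀)
    (hv : ∀ i, ContinuousAt (fun x => (⟨f x, v i x⟩ : TangentBundle I M)) x₀)
    (hli : LinearIndependent 𝕜 fun i => v i x₀) :
    ∀ᶠ x in nhds x₀, LinearIndependent 𝕜 fun i => v i x := by
  let e := trivializationAt E (TangentSpace I : M → Type _) (f x₀)
  have hb : f x₀ ∈ e.baseSet := FiberBundle.mem_baseSet_trivializationAt' (f x₀)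
  have hcont : ContinuousAt (fun x i => (e ⟨f x, v i x⟩).2) x₀ :=
    continuousAt_pi.2 fun i => ((FiberBundle.continuousAt_totalSpace E _).1 (hv i)).2
  have hx₀ : LinearIndependent 𝕜 fun i => (e ⟨f x₀, v i x₀⟩).2 :=
    hli.map' (e.linearEquivAt 𝕜 (f x₀) hb).toLinearMap (LinearEquiv.ker _)
  filter_upwards [hf (e.open_baseSet.mem_nhds hb),
    hcont (isOpen_setOfPred_linearIndependent.mem_nhds hx₀)] with x hx hxli
  refine LinearIndependent.of_comp (e.linearEquivAt 𝕜 (f x) hx).toLinearMap ?_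
  exact hxli

/-- A vector field along a constant map is continuous as a map to the tangent space. -/
theorem continuousAt_of_continuousAt_totalSpaceMk [IsManifold I 1 M] {X : Type*}
    [TopologicalSpace X] {x : M} {v : X → TangentSpace I x} {s : X}
    (h : ContinuousAt (fun s => (⟨x, v s⟩ : TangentBundle I M)) s) : ContinuousAt v s :=
  ((FiberBundle.totalSpaceMk_isInducing E (TangentSpace I : M → Type _) x).continuousAt_iff).2 h

theorem Distribution.eventually_finrank_eq {r : ℕ∞ω} [IsManifold I 1 M] (F : Distribution I M r)
    (x₀ : M) : ∀ᶠ x in nhds x₀,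
      Module.finrank 𝕜 (F.fiber x) = Module.finrank 𝕜 (F.fiber x₀) := by
  obtain ⟨U, hU, hx₀, k, X, -, hX⟩ := F.exists_frame x₀
  have h : ∀ x ∈ U, Module.finrank 𝕜 (F.fiber x) = k := fun x hx => by
    rw [← (hX x hx).2, finrank_span_eq_card (hX x hx).1, Fintype.card_fin]
  filter_upwards [hU.mem_nhds hx₀] with x hx
  rw [h x hx, h x₀ hx₀]

end Manifold

/-! ### Distributions on a product -/

section Product

variable {𝕜 : Type*} [RCLike 𝕜]
  {E₁ : Type*} [NormedAddCommGroup E₁] [NormedSpace 𝕜 E₁]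
  {H₁ : Type*} [TopologicalSpace H₁] {I₁ : ModelWithCorners 𝕜 E₁ H₁}
  {M₁ : Type*} [TopologicalSpace M₁] [ChartedSpace H₁ M₁]
  {E₂ : Type*} [NormedAddCommGroup E₂] [NormedSpace 𝕜 E₂]
  {H₂ : Type*} [TopologicalSpace H₂] {I₂ : ModelWithCorners 𝕜 E₂ H₂}
  {M₂ : Type*} [TopologicalSpace M₂] [ChartedSpace H₂ M₂]

theorem tangent_prod_ext {x : M₁ × M₂} {v w : TangentSpace (I₁.prod I₂) x}
    (h₁ : mfderiv (I₁.prod I₂) I₁ Prod.fst x v = mfderiv (I₁.prod I₂) I₁ Prod.fst x w)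
    (h₂ : mfderiv (I₁.prod I₂) I₂ Prod.snd x v = mfderiv (I₁.prod I₂) I₂ Prod.snd x w) :
    v = w := by
  rw [mfderiv_fst] at h₁
  rw [mfderiv_snd] at h₂
  exact Prod.ext h₁ h₂

theorem exists_tangent_prod (x : M₁ × M₂) (v₁ : TangentSpace I₁ x.1) (v₂ : TangentSpace I₂ x.2) :
    ∃ v : TangentSpace (I₁.prod I₂) x, mfderiv (I₁.prod I₂) I₁ Prod.fst x v = v₁ ∧
      mfderiv (I₁.prod I₂) I₂ Prod.snd x v = v₂ := by
  rw [mfderiv_fst, mfderiv_snd]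
  exact ⟨((v₁, v₂) : E₁ × E₂), rfl, rfl⟩

theorem exists_tangent_prod_equiv (x : M₁ × M₂) (g₁ : TangentSpace I₁ x.1 ≃ₗ[𝕜] TangentSpace I₁ x.1)
    (g₂ : TangentSpace I₂ x.2 ≃ₗ[𝕜] TangentSpace I₂ x.2) :
    ∃ g : TangentSpace (I₁.prod I₂) x ≃ₗ[𝕜] TangentSpace (I₁.prod I₂) x,
      (∀ v, mfderiv (I₁.prod I₂) I₁ Prod.fst x (g v)
        = g₁ (mfderiv (I₁.prod I₂) I₁ Prod.fst x v)) ∧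
      ∀ v, mfderiv (I₁.prod I₂) I₂ Prod.snd x (g v)
        = g₂ (mfderiv (I₁.prod I₂) I₂ Prod.snd x v) := by
  rw [mfderiv_fst, mfderiv_snd]
  exact ⟨LinearEquiv.prodCongr (R := 𝕜) (M := E₁) (M₂ := E₁) (M₃ := E₂) (M₄ := E₂) g₁ g₂,
    fun _ => rfl, fun _ => rfl⟩

theorem BilinField.prod_apply (ω₁ : BilinField I₁ M₁) (ω₂ : BilinField I₂ M₂) (x : M₁ × M₂)
    (u v : TangentSpace (I₁.prod I₂) x) :
    ω₁.prod ω₂ x u v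
      = ω₁ x.1 (mfderiv (I₁.prod I₂) I₁ Prod.fst x u) (mfderiv (I₁.prod I₂) I₁ Prod.fst x v)
        + ω₂ x.2 (mfderiv (I₁.prod I₂) I₂ Prod.snd x u)
          (mfderiv (I₁.prod I₂) I₂ Prod.snd x v) := rfl

/-- The projection of a subspace of the tangent space of a product to the first factor. -/
noncomputable def fstFiber {x : M₁ × M₂} (W : Submodule 𝕜 (TangentSpace (I₁.prod I₂) x)) :
    Submodule 𝕜 (TangentSpace I₁ x.1) :=
  W.map (mfderiv (I₁.prod I₂) I₁ Prod.fst x).toLinearMap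

/-- The projection of a subspace of the tangent space of a product to the second factor. -/
noncomputable def sndFiber {x : M₁ × M₂} (W : Submodule 𝕜 (TangentSpace (I₁.prod I₂) x)) :
    Submodule 𝕜 (TangentSpace I₂ x.2) :=
  W.map (mfderiv (I₁.prod I₂) I₂ Prod.snd x).toLinearMap

/-- `W` is the direct sum of its projections to the tangent spaces of the factors. -/
def IsSplit {x : M₁ × M₂} (W : Submodule 𝕜 (TangentSpace (I₁.prod I₂) x)) : Prop :=
  ∀ v, mfderiv (I₁.prod I₂) I₁ Prod.fst x v ∈ fstFiber W →
    mfderiv (I₁.prod I₂) I₂ Prod.snd x v ∈ sndFiber W → v ∈ W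

/-- The ranks of the two projections can only jump up near a point; since their sum is the locally
constant rank of the distribution, neither jumps. The frames of the projections rest on this. -/
theorem finrank_of_isSplit [FiniteDimensional 𝕜 E₁] [FiniteDimensional 𝕜 E₂] {x : M₁ × M₂}
    {W : Submodule 𝕜 (TangentSpace (I₁.prod I₂) x)} (hW : IsSplit W) :
    Module.finrank 𝕜 (fstFiber W) + Module.finrank 𝕜 (sndFiber W) = Module.finrank 𝕜 W := by
  have := finiteDimensional_tangentSpace (𝕜 := 𝕜) (I := I₁) x.1
  have := finiteDimensional_tangentSpace (𝕜 := 𝕜) (I := I₂) x.2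
  let p₁ := (mfderiv (I₁.prod I₂) I₁ Prod.fst x).toLinearMap
  let p₂ := (mfderiv (I₁.prod I₂) I₂ Prod.snd x).toLinearMap
  let e : W →ₗ[𝕜] fstFiber W × sndFiber W := (p₁.submoduleMap W).prod (p₂.submoduleMap W)
  have he : Function.Bijective e := by
    constructor
    · intro v w h
      have h' := Prod.ext_iff.1 h
      exact Subtype.ext (tangent_prod_ext (congrArg Subtype.val h'.1) (congrArg Subtype.val h'.2))
    · rintro ⟨⟨v₁, h₁⟩, ⟨v₂, h₂⟩⟩
      obtain ⟨v, rfl, rfl⟩ := exists_tangent_prod x v₁ v₂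
      exact ⟨⟨v, hW v h₁ h₂⟩, rfl⟩
  rw [← Module.finrank_prod, (LinearEquiv.ofBijective e he).finrank_eq]

theorem map_span_range {ι K V W : Type*} [Semiring K] [AddCommMonoid V] [AddCommMonoid W]
    [Module K V] [Module K W] (f : V →ₗ[K] W) (v : ι → V) :
    (Submodule.span K (range v)).map f = Submodule.span K (range fun i => f (v i)) := by
  rw [Submodule.map_span, ← range_comp]
  rfl

/-- Lower semicontinuity of rank: a subfamily that is a basis of the span at $x_0$ stays independent
nearby. -/
theorem eventually_linearIndependent_subfamily {E : Type*} [NormedAddCommGroup E]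
    [NormedSpace 𝕜 E] {H : Type*} [TopologicalSpace H] {I : ModelWithCorners 𝕜 E H}
    {M : Type*} [TopologicalSpace M] [ChartedSpace H M] [IsManifold I 1 M] {X : Type*}
    [TopologicalSpace X] {f : X → M} {k : ℕ} {v : Fin k → ∀ x, TangentSpace I (f x)} {x₀ : X}
    (hf : ContinuousAt f x₀)
    (hv : ∀ i, ContinuousAt (fun x => (⟨f x, v i x⟩ : TangentBundle I M)) x₀) :
    ∃ (n : ℕ) (σ : Fin n → Fin k),
      Module.finrank 𝕜 (Submodule.span 𝕜 (range fun i => v i x₀)) = n ∧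
      ∀ᶠ x in nhds x₀, LinearIndependent 𝕜 fun i => v (σ i) x := by
  obtain ⟨n, σ, hli, hspan⟩ := exists_fin_linearIndependent_subfamily (K := 𝕜) fun i => v i x₀
  refine ⟨n, σ, ?_, eventually_linearIndependent hf (fun i => hv (σ i)) hli⟩
  rw [← hspan, finrank_span_eq_card hli, Fintype.card_fin]

/-- The projections of a distribution on a product that splits have local frames. -/
theorem Distribution.exists_frames_of_isSplit [FiniteDimensional 𝕜 E₁] [FiniteDimensional 𝕜 E₂]
    {r : ℕ∞ω} [IsManifold I₁ 1 M₁] [IsManifold I₂ 1 M₂]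
    (F : Distribution (I₁.prod I₂) (M₁ × M₂) r) (hF : ∀ x, IsSplit (F.fiber x)) (x₀ : M₁ × M₂) :
    ∃ U : Set (M₁ × M₂), IsOpen U ∧ x₀ ∈ U ∧
      (∃ (n : ℕ) (Y : Fin n → ∀ x : M₁ × M₂, TangentSpace I₁ x.1),
        (∀ i, ContMDiffOn (I₁.prod I₂) I₁.tangent r
          (fun x => (⟨x.1, Y i x⟩ : TangentBundle I₁ M₁)) U) ∧
        ∀ x ∈ U, LinearIndependent 𝕜 (fun i => Y i x) ∧
          Submodule.span 𝕜 (range fun i => Y i x) = fstFiber (F.fiber x)) ∧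
      (∃ (n : ℕ) (Y : Fin n → ∀ x : M₁ × M₂, TangentSpace I₂ x.2),
        (∀ i, ContMDiffOn (I₁.prod I₂) I₂.tangent r
          (fun x => (⟨x.2, Y i x⟩ : TangentBundle I₂ M₂)) U) ∧
        ∀ x ∈ U, LinearIndependent 𝕜 (fun i => Y i x) ∧
          Submodule.span 𝕜 (range fun i => Y i x) = sndFiber (F.fiber x)) := by
  obtain ⟨U, hU, hx₀, k, X, hXs, hX⟩ := F.exists_frame x₀
  let Y₁ : Fin k → ∀ x : M₁ × M₂, TangentSpace I₁ x.1 := fun i x =>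
    mfderiv (I₁.prod I₂) I₁ Prod.fst x (X i x)
  let Y₂ : Fin k → ∀ x : M₁ × M₂, TangentSpace I₂ x.2 := fun i x =>
    mfderiv (I₁.prod I₂) I₂ Prod.snd x (X i x)
  -- The tangent map costs one derivative; the projection is taken of class `ω`, so the result still
  -- has class $C^r$.
  have hs₁ : ∀ i, ContMDiffOn (I₁.prod I₂) I₁.tangent r
      (fun x => (⟨x.1, Y₁ i x⟩ : TangentBundle I₁ M₁)) U := fun i =>
    (((contMDiff_fst (I := I₁) (J := I₂) (M := M₁) (N := M₂) (n := ω)).contMDiff_tangentMap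
      (m := r) le_top).comp_contMDiffOn (hXs i) :)
  have hs₂ : ∀ i, ContMDiffOn (I₁.prod I₂) I₂.tangent r
      (fun x => (⟨x.2, Y₂ i x⟩ : TangentBundle I₂ M₂)) U := fun i =>
    (((contMDiff_snd (I := I₁) (J := I₂) (M := M₁) (N := M₂) (n := ω)).contMDiff_tangentMap
      (m := r) le_top).comp_contMDiffOn (hXs i) :)
  have hspan₁ : ∀ x ∈ U, Submodule.span 𝕜 (range fun i => Y₁ i x) = fstFiber (F.fiber x) :=
    fun x hx => by rw [← (hX x hx).2, fstFiber, map_span_range]; rfl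
  have hspan₂ : ∀ x ∈ U, Submodule.span 𝕜 (range fun i => Y₂ i x) = sndFiber (F.fiber x) :=
    fun x hx => by rw [← (hX x hx).2, sndFiber, map_span_range]; rfl
  have hrank : ∀ x ∈ U, Module.finrank 𝕜 (fstFiber (F.fiber x))
      + Module.finrank 𝕜 (sndFiber (F.fiber x)) = k := fun x hx => by
    rw [finrank_of_isSplit (hF x), ← (hX x hx).2, finrank_span_eq_card (hX x hx).1,
      Fintype.card_fin]
  obtain ⟨n₁, σ₁, hn₁, hli₁⟩ := eventually_linearIndependent_subfamily (I := I₁) (v := Y₁)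
    (continuousAt_fst (p := x₀)) fun i => (hs₁ i).continuousOn.continuousAt (hU.mem_nhds hx₀)
  obtain ⟨n₂, σ₂, hn₂, hli₂⟩ := eventually_linearIndependent_subfamily (I := I₂) (v := Y₂)
    (continuousAt_snd (p := x₀)) fun i => (hs₂ i).continuousOn.continuousAt (hU.mem_nhds hx₀)
  have hsum : n₁ + n₂ = k := by
    rw [← hn₁, ← hn₂, hspan₁ x₀ hx₀, hspan₂ x₀ hx₀, hrank x₀ hx₀]
  obtain ⟨U', hU'sub, hU', hx₀'⟩ := eventually_nhds_iff.1
    ((hli₁.and hli₂).and (hU.mem_nhds hx₀))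
  -- The independent subfamilies bound the two ranks below by $n_1$ and $n_2$, and the ranks add up
  -- to $k = n_1 + n_2$; both bounds are therefore equalities.
  have hspans : ∀ x ∈ U',
      Submodule.span 𝕜 (range fun i => Y₁ (σ₁ i) x) = fstFiber (F.fiber x) ∧
      Submodule.span 𝕜 (range fun i => Y₂ (σ₂ i) x) = sndFiber (F.fiber x) := by
    intro x hx
    obtain ⟨⟨h₁, h₂⟩, hxU⟩ := hU'sub x hx
    have := finiteDimensional_tangentSpace (𝕜 := 𝕜) (I := I₁) x.1
    have := finiteDimensional_tangentSpace (𝕜 := 𝕜) (I := I₂) x.2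
    have hle₁ : Submodule.span 𝕜 (range fun i => Y₁ (σ₁ i) x) ≤ fstFiber (F.fiber x) := by
      rw [← hspan₁ x hxU]
      exact Submodule.span_mono (range_comp_subset_range σ₁ fun i => Y₁ i x)
    have hle₂ : Submodule.span 𝕜 (range fun i => Y₂ (σ₂ i) x) ≤ sndFiber (F.fiber x) := by
      rw [← hspan₂ x hxU]
      exact Submodule.span_mono (range_comp_subset_range σ₂ fun i => Y₂ i x)
    have hd₁ := Submodule.finrank_mono hle₁
    have hd₂ := Submodule.finrank_mono hle₂
    have hk := hrank x hxU
    have hc₁ : Module.finrank 𝕜 (Submodule.span 𝕜 (range fun i => Y₁ (σ₁ i) x)) = n₁ := by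
      rw [finrank_span_eq_card h₁, Fintype.card_fin]
    have hc₂ : Module.finrank 𝕜 (Submodule.span 𝕜 (range fun i => Y₂ (σ₂ i) x)) = n₂ := by
      rw [finrank_span_eq_card h₂, Fintype.card_fin]
    exact ⟨Submodule.eq_of_le_of_finrank_le hle₁ (by omega),
      Submodule.eq_of_le_of_finrank_le hle₂ (by omega)⟩
  have hsub : U' ⊆ U := fun x hx => (hU'sub x hx).2
  exact ⟨U', hU', hx₀',
    ⟨n₁, fun i => Y₁ (σ₁ i), fun i => (hs₁ _).mono hsub, fun x hx =>
      ⟨(hU'sub x hx).1.1, (hspans x hx).1⟩⟩,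
    ⟨n₂, fun i => Y₂ (σ₂ i), fun i => (hs₂ _).mono hsub, fun x hx =>
      ⟨(hU'sub x hx).1.2, (hspans x hx).2⟩⟩⟩

end Product

/-! ### Invariant distributions on a product -/

section Constancy

variable {𝕜 : Type*} [RCLike 𝕜]
  {E : Type*} [NormedAddCommGroup E] [NormedSpace 𝕜 E] [FiniteDimensional 𝕜 E]
  {H : Type*} [TopologicalSpace H] {I : ModelWithCorners 𝕜 E H}
  {M : Type*} [TopologicalSpace M] [ChartedSpace H M]

theorem IsCompatiblePair.finite_setOf_isInvariantSubspace {r : ℕ∞ω} [IsManifold I 1 M]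
    {ω₀ ω₁ : BilinField I M} (h : IsCompatiblePair r ω₀ ω₁) (x : M) :
    {W : Submodule 𝕜 (TangentSpace I x) |
      IsInvariantSubspace (fun u v => ω₀ x u v) (fun u v => ω₁ x u v) W}.Finite := by
  have := finiteDimensional_tangentSpace (𝕜 := 𝕜) (I := I) x
  exact BiHam.finite_setOf_isInvariantSubspace two_ne_zero
    (LinearMap.mk₂ 𝕜 (fun u v => ω₀ x u v) (by simp) (by simp) (by simp) (by simp))
    (LinearMap.mk₂ 𝕜 (fun u v => ω₁ x u v) (by simp) (by simp) (by simp) (by simp))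
    (fun u hu => h.nondegenerate x u hu) (h.alternating₀ x) (h.alternating₁ x)

/-- A continuous family of subspaces of a tangent space that takes finitely many values is locally
constant. -/
theorem eventually_eq_of_frame_of_finite [IsManifold I 1 M] {X : Type*} [TopologicalSpace X]
    {x : M} {W : X → Submodule 𝕜 (TangentSpace I x)} {S : Set (Submodule 𝕜 (TangentSpace I x))}
    (hS : S.Finite) (hWS : ∀ s, W s ∈ S) {s₀ : X} {n : ℕ} {Y : Fin n → X → TangentSpace I x}
    (hcont : ∀ i, ContinuousAt (fun s => (⟨x, Y i s⟩ : TangentBundle I M)) s₀)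
    (hY : ∀ᶠ s in nhds s₀, LinearIndependent 𝕜 (fun i => Y i s) ∧
      Submodule.span 𝕜 (range fun i => Y i s) = W s) :
    ∀ᶠ s in nhds s₀, W s = W s₀ := by
  have := finiteDimensional_tangentSpace (𝕜 := 𝕜) (I := I) x
  have hdim : ∀ s, (LinearIndependent 𝕜 (fun i => Y i s) ∧
      Submodule.span 𝕜 (range fun i => Y i s) = W s) → Module.finrank 𝕜 (W s) = n :=
    fun s hs => by rw [← hs.2, finrank_span_eq_card hs.1, Fintype.card_fin]
  -- Some frame vector at $s_0$ lies outside the closed set $W'$ and stays outside nearby. Excluding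
  -- the finitely many such $W'$ leaves only values containing $W_{s_0}$, and equality of dimensions
  -- concludes.
  have hne : ∀ W' ∈ S, ¬ W s₀ ≤ W' → ∀ᶠ s in nhds s₀, W s ≠ W' := by
    intro W' _ hW'
    rw [← hY.self_of_nhds.2, Submodule.span_le, range_subset_iff, not_forall] at hW'
    obtain ⟨i, hi⟩ := hW'
    have hclosed : IsClosed (W' : Set (TangentSpace I x)) :=
      by
      have : T2Space (TangentSpace I x) := inferInstanceAs (T2Space E)
      exact W'.closed_of_finiteDimensional
    filter_upwards [hY, continuousAt_of_continuousAt_totalSpaceMk (hcont i)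
      (hclosed.isOpen_compl.mem_nhds hi)] with s hs hsi heq
    apply hsi
    rw [← heq, ← hs.2]
    exact Submodule.subset_span ⟨i, rfl⟩
  have hall : ∀ᶠ s in nhds s₀, ∀ W' ∈ S, ¬ W s₀ ≤ W' → W s ≠ W' :=
    (Filter.eventually_all_finite hS).2 fun W' hW' => by
      by_cases h : W s₀ ≤ W'
      · exact Filter.Eventually.of_forall fun s hs => absurd h hs
      · exact (hne W' hW' h).mono fun s hs _ => hs
  filter_upwards [hall, hY] with s hs hYs
  have hle : W s₀ ≤ W s := by
    by_contra h
    exact hs (W s) (hWS s) h rfl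
  exact (Submodule.eq_of_le_of_finrank_le hle
    (by rw [hdim s hYs, hdim s₀ hY.self_of_nhds])).symm

end Constancy

section Product

variable {𝕜 : Type*} [RCLike 𝕜]
  {E₁ : Type*} [NormedAddCommGroup E₁] [NormedSpace 𝕜 E₁]
  {H₁ : Type*} [TopologicalSpace H₁] {I₁ : ModelWithCorners 𝕜 E₁ H₁}
  {M₁ : Type*} [TopologicalSpace M₁] [ChartedSpace H₁ M₁]
  {E₂ : Type*} [NormedAddCommGroup E₂] [NormedSpace 𝕜 E₂]
  {H₂ : Type*} [TopologicalSpace H₂] {I₂ : ModelWithCorners 𝕜 E₂ H₂}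
  {M₂ : Type*} [TopologicalSpace M₂] [ChartedSpace H₂ M₂]
  {r : ℕ∞ω} [IsManifold I₁ 1 M₁] [IsManifold I₂ 1 M₂]
  {F : Distribution (I₁.prod I₂) (M₁ × M₂) r}
  {ω₀' ω₁' : BilinField I₁ M₁} {ω₀'' ω₁'' : BilinField I₂ M₂}

/-- An invariant distribution splits, since the identity of one factor and minus the identity of
the other define an automorphism. -/
theorem Distribution.IsInvariant.isSplit
    (hF : F.IsInvariant (ω₀'.prod ω₀'') (ω₁'.prod ω₁'')) (x : M₁ × M₂) : IsSplit (F.fiber x) := by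
  rintro v ⟨a, ha, hav⟩ ⟨b, hb, hbv⟩
  replace hav : mfderiv (I₁.prod I₂) I₁ Prod.fst x a = mfderiv (I₁.prod I₂) I₁ Prod.fst x v := hav
  replace hbv : mfderiv (I₁.prod I₂) I₂ Prod.snd x b = mfderiv (I₁.prod I₂) I₂ Prod.snd x v := hbv
  obtain ⟨g, hg₁, hg₂⟩ := exists_tangent_prod_equiv (I₁ := I₁) (I₂ := I₂) x
    (LinearEquiv.refl 𝕜 _) (LinearEquiv.neg 𝕜)
  have hg : ∀ w ∈ F.fiber x, g w ∈ F.fiber x := by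
    refine hF x g (fun u v => ?_) fun u v => ?_
    all_goals simp [-mfderiv_fst, -mfderiv_snd, BilinField.prod_apply, hg₁, hg₂]
  -- Here $g = (\mathrm{id}, -\mathrm{id})$, so $a + ga$ is twice the first component of $v$ and $b
  -- - gb$ twice the second.
  have h : (2 : 𝕜) • v = (a + g a) + (b - g b) := by
    refine tangent_prod_ext ?_ ?_
    · simp [-mfderiv_fst, hg₁, hav, two_smul]
    · simp [-mfderiv_snd, hg₂, hbv, two_smul]
  have hmem : (2 : 𝕜)⁻¹ • ((2 : 𝕜) • v) ∈ F.fiber x := by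
    rw [h]
    exact Submodule.smul_mem _ _ (add_mem (add_mem ha (hg a ha)) (sub_mem hb (hg b hb)))
  rwa [smul_smul, inv_mul_cancel₀ two_ne_zero, one_smul] at hmem

/-- An automorphism of one factor, extended by the identity of the other, preserves the product
forms. -/
theorem Distribution.IsInvariant.isInvariantSubspace_fstFiber
    (hF : F.IsInvariant (ω₀'.prod ω₀'') (ω₁'.prod ω₁'')) (x : M₁ × M₂) :
    IsInvariantSubspace (fun u v => ω₀' x.1 u v) (fun u v => ω₁' x.1 u v)
      (fstFiber (F.fiber x)) := by
  rintro g h₀ h₁ _ ⟨v, hv, rfl⟩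
  obtain ⟨G, hG₁, hG₂⟩ := exists_tangent_prod_equiv (I₁ := I₁) (I₂ := I₂) x g
    (LinearEquiv.refl 𝕜 _)
  refine ⟨G v, hF x G (fun u v => ?_) (fun u v => ?_) v hv, hG₁ v⟩
  · simp only [BilinField.prod_apply, hG₁, hG₂, LinearEquiv.refl_apply]
    exact congrArg (· + _) (h₀ _ _)
  · simp only [BilinField.prod_apply, hG₁, hG₂, LinearEquiv.refl_apply]
    exact congrArg (· + _) (h₁ _ _)

theorem Distribution.IsInvariant.isInvariantSubspace_sndFiber
    (hF : F.IsInvariant (ω₀'.prod ω₀'') (ω₁'.prod ω₁'')) (x : M₁ × M₂) :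
    IsInvariantSubspace (fun u v => ω₀'' x.2 u v) (fun u v => ω₁'' x.2 u v)
      (sndFiber (F.fiber x)) := by
  rintro g h₀ h₁ _ ⟨v, hv, rfl⟩
  obtain ⟨G, hG₁, hG₂⟩ := exists_tangent_prod_equiv (I₁ := I₁) (I₂ := I₂) x
    (LinearEquiv.refl 𝕜 _) g
  refine ⟨G v, hF x G (fun u v => ?_) (fun u v => ?_) v hv, hG₂ v⟩
  · simp only [BilinField.prod_apply, hG₁, hG₂, LinearEquiv.refl_apply]
    exact congrArg (_ + ·) (h₀ _ _)
  · simp only [BilinField.prod_apply, hG₁, hG₂, LinearEquiv.refl_apply]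
    exact congrArg (_ + ·) (h₁ _ _)

variable [FiniteDimensional 𝕜 E₁] [FiniteDimensional 𝕜 E₂]

/-- All these projections lie in the one space $T_{x_1}M_1$ and vary continuously with the second
coordinate among finitely many invariant subspaces, so connectedness of $M_2$ makes them constant.
-/
theorem Distribution.IsInvariant.fstFiber_eq [PreconnectedSpace M₂]
    (h' : IsCompatiblePair r ω₀' ω₁') (hF : F.IsInvariant (ω₀'.prod ω₀'') (ω₁'.prod ω₁''))
    (x₁ : M₁) (s t : M₂) : fstFiber (F.fiber (x₁, s)) = fstFiber (F.fiber (x₁, t)) := by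
  let W : M₂ → Submodule 𝕜 (TangentSpace I₁ x₁) := fun s => fstFiber (F.fiber (x₁, s))
  have hW : IsLocallyConstant W := by
    refine (IsLocallyConstant.iff_eventually_eq _).2 fun s₀ => ?_
    obtain ⟨U, hU, hx₀, ⟨n, Y, hYs, hY⟩, -⟩ := F.exists_frames_of_isSplit hF.isSplit (x₁, s₀)
    have hc : Continuous fun s : M₂ => (x₁, s) := by fun_prop
    refine eventually_eq_of_frame_of_finite (I := I₁) (h'.finite_setOf_isInvariantSubspace x₁)
      (fun s => hF.isInvariantSubspace_fstFiber (x₁, s)) (Y := fun i s => Y i (x₁, s))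
      (fun i => ?_) ?_
    · exact ((hYs i).continuousOn.continuousAt (hU.mem_nhds hx₀)).comp
        (f := fun s : M₂ => (x₁, s)) hc.continuousAt
    · filter_upwards [(hU.preimage hc).mem_nhds hx₀] with s hs using hY _ hs
  exact hW.apply_eq_of_preconnectedSpace s t

theorem Distribution.IsInvariant.sndFiber_eq [PreconnectedSpace M₁]
    (h'' : IsCompatiblePair r ω₀'' ω₁'') (hF : F.IsInvariant (ω₀'.prod ω₀'') (ω₁'.prod ω₁''))
    (x₂ : M₂) (s t : M₁) : sndFiber (F.fiber (s, x₂)) = sndFiber (F.fiber (t, x₂)) := by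
  let W : M₁ → Submodule 𝕜 (TangentSpace I₂ x₂) := fun s => sndFiber (F.fiber (s, x₂))
  have hW : IsLocallyConstant W := by
    refine (IsLocallyConstant.iff_eventually_eq _).2 fun s₀ => ?_
    obtain ⟨U, hU, hx₀, -, ⟨n, Y, hYs, hY⟩⟩ := F.exists_frames_of_isSplit hF.isSplit (s₀, x₂)
    have hc : Continuous fun s : M₁ => (s, x₂) := by fun_prop
    refine eventually_eq_of_frame_of_finite (I := I₂) (h''.finite_setOf_isInvariantSubspace x₂)
      (fun s => hF.isInvariantSubspace_sndFiber (s, x₂)) (Y := fun i s => Y i (s, x₂))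
      (fun i => ?_) ?_
    · exact ((hYs i).continuousOn.continuousAt (hU.mem_nhds hx₀)).comp
        (f := fun s : M₁ => (s, x₂)) hc.continuousAt
    · filter_upwards [(hU.preimage hc).mem_nhds hx₀] with s hs using hY _ hs
  exact hW.apply_eq_of_preconnectedSpace s t

/-- The restriction of the first component of a split distribution to a slice. -/
noncomputable def Distribution.fstSlice (F : Distribution (I₁.prod I₂) (M₁ × M₂) r)
    (hF : ∀ x, IsSplit (F.fiber x)) (s : M₂) : Distribution I₁ M₁ r where
  fiber x := fstFiber (F.fiber (x, s))
  exists_frame x₀ := by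
    obtain ⟨U, hU, hx₀, ⟨n, Y, hYs, hY⟩, -⟩ := F.exists_frames_of_isSplit hF (x₀, s)
    have hc : ContMDiff I₁ (I₁.prod I₂) r fun x : M₁ => (x, s) :=
      contMDiff_id.prodMk contMDiff_const
    exact ⟨(fun x => (x, s)) ⁻¹' U, hU.preimage hc.continuous, hx₀, n, fun i x => Y i (x, s),
      fun i => (hYs i).comp hc.contMDiffOn (subset_refl _), fun x hx => hY (x, s) hx⟩

/-- The restriction of the second component of a split distribution to a slice. -/
noncomputable def Distribution.sndSlice (F : Distribution (I₁.prod I₂) (M₁ × M₂) r)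
    (hF : ∀ x, IsSplit (F.fiber x)) (s : M₁) : Distribution I₂ M₂ r where
  fiber x := sndFiber (F.fiber (s, x))
  exists_frame x₀ := by
    obtain ⟨U, hU, hx₀, -, ⟨n, Y, hYs, hY⟩⟩ := F.exists_frames_of_isSplit hF (s, x₀)
    have hc : ContMDiff I₂ (I₁.prod I₂) r fun x : M₂ => (s, x) :=
      contMDiff_const.prodMk contMDiff_id
    exact ⟨(fun x => (s, x)) ⁻¹' U, hU.preimage hc.continuous, hx₀, n, fun i x => Y i (s, x),
      fun i => (hYs i).comp hc.contMDiffOn (subset_refl _), fun x hx => hY (s, x) hx⟩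

/-- An invariant distribution on a product of connected manifolds is a direct product of invariant
distributions. -/
theorem Distribution.IsInvariant.exists_isProd [ConnectedSpace M₁] [ConnectedSpace M₂]
    (h' : IsCompatiblePair r ω₀' ω₁') (h'' : IsCompatiblePair r ω₀'' ω₁'')
    (hF : F.IsInvariant (ω₀'.prod ω₀'') (ω₁'.prod ω₁'')) :
    ∃ (F' : Distribution I₁ M₁ r) (F'' : Distribution I₂ M₂ r),
      F'.IsInvariant ω₀' ω₁' ∧ F''.IsInvariant ω₀'' ω₁'' ∧ F.IsProd F' F'' := by
  obtain ⟨s₁⟩ : Nonempty M₁ := inferInstance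
  obtain ⟨s₂⟩ : Nonempty M₂ := inferInstance
  refine ⟨F.fstSlice hF.isSplit s₂, F.sndSlice hF.isSplit s₁,
    fun x => hF.isInvariantSubspace_fstFiber (x, s₂),
    fun x => hF.isInvariantSubspace_sndFiber (s₁, x), ?_⟩
  rintro ⟨x₁, x₂⟩ v
  have e₁ : (F.fstSlice hF.isSplit s₂).fiber x₁ = fstFiber (F.fiber (x₁, x₂)) :=
    hF.fstFiber_eq h' x₁ s₂ x₂
  have e₂ : (F.sndSlice hF.isSplit s₁).fiber x₂ = sndFiber (F.fiber (x₁, x₂)) :=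
    hF.sndFiber_eq h'' x₂ s₁ x₁
  rw [e₁, e₂]
  exact ⟨fun hv => ⟨⟨v, hv, rfl⟩, ⟨v, hv, rfl⟩⟩, fun hv => hF.isSplit _ v hv.1 hv.2⟩

end Product

/-! ### Integrability -/

/-! ### Images of integral manifolds under a surjective map -/

section Image

variable {𝕜 : Type*} [RCLike 𝕜]
  {E : Type*} [NormedAddCommGroup E] [NormedSpace 𝕜 E]
  {H : Type*} [TopologicalSpace H] {I : ModelWithCorners 𝕜 E H}
  {M : Type*} [TopologicalSpace M] [ChartedSpace H M]
  {E' : Type*} [NormedAddCommGroup E'] [NormedSpace 𝕜 E'] [FiniteDimensional 𝕜 E']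
  {H' : Type*} [TopologicalSpace H'] {J : ModelWithCorners 𝕜 E' H'}
  {N : Type*} [TopologicalSpace N] [ChartedSpace H' N]
  {r : ℕ∞ω} [IsManifold I 1 M] [IsManifold J 1 N]

/-- A distribution is integrable if it is the image of an integrable distribution under a surjective
map: restrict the image of an integral manifold to a transversal of the kernel. -/
theorem Distribution.IsIntegrable.of_map {F : Distribution I M r} {G : Distribution J N r}
    (hr : 1 ≤ r) {p : M → N} (hp : ContMDiff I J r p) (hsurj : Function.Surjective p)
    (hFG : ∀ x, (F.fiber x).map (mfderiv I J p x).toLinearMap = G.fiber (p x))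
    (hF : F.IsIntegrable) : G.IsIntegrable := by
  intro y₀
  obtain ⟨x₀, rfl⟩ := hsurj y₀
  obtain ⟨k, U, γ, hU, h0, rfl, hγ, hγU⟩ := hF x₀
  have hr0 : r ≠ 0 := (lt_of_lt_of_le zero_lt_one hr).ne'
  let δ : (Fin k → 𝕜) → N := p ∘ γ
  have hδ : ContMDiffOn 𝓘(𝕜, Fin k → 𝕜) J r δ U := hp.comp_contMDiffOn hγ
  have hδd : ∀ t ∈ U, MDifferentiableAt 𝓘(𝕜, Fin k → 𝕜) J δ t := fun t ht =>
    (hδ.contMDiffAt (hU.mem_nhds ht)).mdifferentiableAt hr0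
  -- The differential of $\delta = p \circ \gamma$ already has the right range; only injectivity is
  -- missing.
  have hrange : ∀ t ∈ U, (mfderiv 𝓘(𝕜, Fin k → 𝕜) J δ t).toLinearMap.range = G.fiber (δ t) := by
    intro t ht
    have hcomp : mfderiv 𝓘(𝕜, Fin k → 𝕜) J δ t
        = (mfderiv I J p (γ t)).comp (mfderiv 𝓘(𝕜, Fin k → 𝕜) I γ t) :=
      mfderiv_comp t (hp.mdifferentiableAt hr0)
        ((hγ.contMDiffAt (hU.mem_nhds ht)).mdifferentiableAt hr0)
    rw [show G.fiber (δ t) = _ from (hFG (γ t)).symm, hcomp]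
    ext w
    constructor
    · rintro ⟨s, rfl⟩
      exact ⟨_, ((hγU t ht).2 _).2 ⟨s, rfl⟩, rfl⟩
    · rintro ⟨v, hv, rfl⟩
      obtain ⟨s, rfl⟩ := ((hγU t ht).2 _).1 hv
      exact ⟨s, rfl⟩
  -- a transversal
  let b := Pi.basisFun 𝕜 (Fin k)
  obtain ⟨n, σ, hli, hspan⟩ := exists_fin_linearIndependent_subfamily (K := 𝕜)
    fun i => mfderiv 𝓘(𝕜, Fin k → 𝕜) J δ 0 (b i)
  have hrank₀ : Module.finrank 𝕜 (G.fiber (δ 0)) = n := by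
    have : Submodule.span 𝕜 (range fun i => mfderiv 𝓘(𝕜, Fin k → 𝕜) J δ 0 (b i))
        = G.fiber (δ 0) := by
      have hL : ∀ L : (Fin k → 𝕜) →ₗ[𝕜] TangentSpace J (δ 0),
          Submodule.span 𝕜 (range fun i => L (b i)) = L.range := fun L => by
        rw [← Submodule.map_top, ← b.span_eq, map_span_range]
      rw [← hrange 0 h0]
      exact hL _
    rw [← this, ← hspan, finrank_span_eq_card hli, Fintype.card_fin]
  -- The inclusion of a coordinate subspace complementary to the kernel of $d\delta_0$; the chosen
  -- basis vectors have images forming a basis of $G$ at $\delta(0)$.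
  let φ : (Fin n → 𝕜) →L[𝕜] (Fin k → 𝕜) :=
    LinearMap.toContinuousLinearMap (Fintype.linearCombination 𝕜 fun i => b (σ i))
  have hφ : ∀ t, φ t = ∑ i, t i • b (σ i) := fun t => rfl
  have hφ0 : φ 0 = 0 := map_zero φ
  have hφU : IsOpen (φ ⁻¹' U) := hU.preimage φ.continuous
  have h0' : (0 : Fin n → 𝕜) ∈ φ ⁻¹' U := by
    change φ 0 ∈ U
    rwa [hφ0]
  have hcont : ∀ i, ContinuousAt (fun t => (⟨δ (φ t),
      mfderiv 𝓘(𝕜, Fin k → 𝕜) J δ (φ t) (b (σ i))⟩ : TangentBundle J N)) 0 := by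
    intro i
    have h1 : Continuous fun t => (⟨φ t, b (σ i)⟩ : TangentBundle 𝓘(𝕜, Fin k → 𝕜) (Fin k → 𝕜)) :=
      (tangentBundleModelSpaceHomeomorph 𝓘(𝕜, Fin k → 𝕜)).symm.continuous.comp
        (φ.continuous.prodMk continuous_const)
    have h2 := (hδ.continuousOn_tangentMapWithin hr hU.uniqueMDiffOn).comp
      (s := φ ⁻¹' U) h1.continuousOn fun t ht => ht
    refine (h2.continuousAt (hφU.mem_nhds h0')).congr ?_
    filter_upwards [hφU.mem_nhds h0'] with t ht
    simp only [Function.comp_apply, tangentMapWithin]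
    rw [mfderivWithin_of_isOpen hU ht]
  have hev : ∀ᶠ t in nhds (0 : Fin n → 𝕜),
      LinearIndependent 𝕜 (fun i => mfderiv 𝓘(𝕜, Fin k → 𝕜) J δ (φ t) (b (σ i))) := by
    have hδφ : ContinuousAt (fun t => δ (φ t)) 0 :=
      (hδ.continuousOn.comp φ.continuous.continuousOn fun t ht => ht).continuousAt
        (hφU.mem_nhds h0')
    refine eventually_linearIndependent (I := J) (f := fun t => δ (φ t))
      (v := fun i t => mfderiv 𝓘(𝕜, Fin k → 𝕜) J δ (φ t) (b (σ i))) hδφ hcont ?_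
    rw [hφ0]
    exact hli
  have hevr : ∀ᶠ t in nhds (0 : Fin n → 𝕜), Module.finrank 𝕜 (G.fiber (δ (φ t))) = n := by
    have hδφ : ContinuousAt (fun t => δ (φ t)) 0 :=
      (hδ.continuousOn.comp φ.continuous.continuousOn fun t ht => ht).continuousAt
        (hφU.mem_nhds h0')
    have := hδφ.eventually (G.eventually_finrank_eq (δ (φ 0)))
    rwa [hφ0, hrank₀] at this
  obtain ⟨U', hU'sub, hU', h0U'⟩ := eventually_nhds_iff.1
    ((hev.and hevr).and (hφU.mem_nhds h0'))
  refine ⟨n, U', fun t => δ (φ t), hU', h0U', congrArg δ hφ0,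
    hδ.comp (φ.contDiff.contMDiff.contMDiffOn) fun t ht => (hU'sub t ht).2, fun t ht => ?_⟩
  obtain ⟨⟨hlit, hrankt⟩, htU⟩ := hU'sub t ht
  have hder : ∀ s : Fin n → 𝕜, mfderiv 𝓘(𝕜, Fin n → 𝕜) J (fun t => δ (φ t)) t s
      = ∑ i, s i • mfderiv 𝓘(𝕜, Fin k → 𝕜) J δ (φ t) (b (σ i)) := by
    intro s
    have h1 := mfderiv_comp_apply (I := 𝓘(𝕜, Fin n → 𝕜)) t (hδd (φ t) htU)
      φ.differentiableAt.mdifferentiableAt s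
    rw [mfderiv_eq_fderiv, φ.fderiv] at h1
    have hL : ∀ L : (Fin k → 𝕜) →L[𝕜] TangentSpace J (δ (φ t)),
        L (φ s) = ∑ i, s i • L (b (σ i)) := fun L => by
      rw [hφ s, map_sum]
      exact Finset.sum_congr rfl fun i _ => map_smul L _ _
    exact h1.trans (hL _)
  have := finiteDimensional_tangentSpace (𝕜 := 𝕜) (I := J) (δ (φ t))
  -- Near $0$ the rank of $G$ is still $n$, so $n$ independent vectors of its fiber span it.
  have hspant : Submodule.span 𝕜 (range fun i => mfderiv 𝓘(𝕜, Fin k → 𝕜) J δ (φ t) (b (σ i)))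
      = G.fiber (δ (φ t)) := by
    refine Submodule.eq_of_le_of_finrank_le ?_ ?_
    · rw [Submodule.span_le, range_subset_iff]
      intro i
      rw [← hrange _ htU]
      exact ⟨b (σ i), rfl⟩
    · rw [finrank_span_eq_card hlit, Fintype.card_fin, hrankt]
  refine ⟨?_, fun v => ?_⟩
  · refine (injective_iff_map_eq_zero _).2 fun s hs => ?_
    replace hs := (hder s).symm.trans hs
    exact funext (Fintype.linearIndependent_iff.1 hlit s hs)
  · rw [← hspant, Submodule.mem_span_range_iff_exists_fun]
    exact ⟨fun ⟨s, hs⟩ => ⟨s, (hder s).trans hs⟩, fun ⟨s, hs⟩ => ⟨s, (hder s).symm.trans hs⟩⟩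

end Image

/-! ### Integrability of a direct product -/

section Product

variable {𝕜 : Type*} [RCLike 𝕜]
  {E₁ : Type*} [NormedAddCommGroup E₁] [NormedSpace 𝕜 E₁]
  {H₁ : Type*} [TopologicalSpace H₁] {I₁ : ModelWithCorners 𝕜 E₁ H₁}
  {M₁ : Type*} [TopologicalSpace M₁] [ChartedSpace H₁ M₁]
  {E₂ : Type*} [NormedAddCommGroup E₂] [NormedSpace 𝕜 E₂]
  {H₂ : Type*} [TopologicalSpace H₂] {I₂ : ModelWithCorners 𝕜 E₂ H₂}
  {M₂ : Type*} [TopologicalSpace M₂] [ChartedSpace H₂ M₂]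
  {r : ℕ∞ω} [IsManifold I₁ 1 M₁] [IsManifold I₂ 1 M₂]
  {F : Distribution (I₁.prod I₂) (M₁ × M₂) r}
  {F' : Distribution I₁ M₁ r} {F'' : Distribution I₂ M₂ r}

theorem Distribution.IsProd.map_fst (h : F.IsProd F' F'') (x : M₁ × M₂) :
    (F.fiber x).map (mfderiv (I₁.prod I₂) I₁ Prod.fst x).toLinearMap = F'.fiber x.1 := by
  ext w
  constructor
  · rintro ⟨v, hv, rfl⟩
    exact ((h x v).1 hv).1
  · intro hw
    obtain ⟨v, h₁, h₂⟩ := exists_tangent_prod (I₁ := I₁) (I₂ := I₂) x w 0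
    exact ⟨v, (h x v).2 ⟨h₁ ▸ hw, h₂ ▸ zero_mem _⟩, h₁⟩

theorem Distribution.IsProd.map_snd (h : F.IsProd F' F'') (x : M₁ × M₂) :
    (F.fiber x).map (mfderiv (I₁.prod I₂) I₂ Prod.snd x).toLinearMap = F''.fiber x.2 := by
  ext w
  constructor
  · rintro ⟨v, hv, rfl⟩
    exact ((h x v).1 hv).2
  · intro hw
    obtain ⟨v, h₁, h₂⟩ := exists_tangent_prod (I₁ := I₁) (I₂ := I₂) x 0 w
    exact ⟨v, (h x v).2 ⟨h₁ ▸ zero_mem _, h₂ ▸ hw⟩, h₂⟩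

/-- The product of the two parametrizations works, with the $k_1 + k_2$ coordinates split into two
blocks by $p_1$ and $p_2$. -/
theorem Distribution.IsProd.isIntegrable (hr : r ≠ 0) (h : F.IsProd F' F'')
    (h' : F'.IsIntegrable) (h'' : F''.IsIntegrable) : F.IsIntegrable := by
  rintro ⟨x₁, x₂⟩
  obtain ⟨k₁, U₁, γ₁, hU₁, h0₁, rfl, hγ₁, hγU₁⟩ := h' x₁
  obtain ⟨k₂, U₂, γ₂, hU₂, h0₂, rfl, hγ₂, hγU₂⟩ := h'' x₂
  let p₁ : (Fin (k₁ + k₂) → 𝕜) →L[𝕜] (Fin k₁ → 𝕜) :=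
    ContinuousLinearMap.pi fun i => ContinuousLinearMap.proj (Fin.castAdd k₂ i)
  let p₂ : (Fin (k₁ + k₂) → 𝕜) →L[𝕜] (Fin k₂ → 𝕜) :=
    ContinuousLinearMap.pi fun i => ContinuousLinearMap.proj (Fin.natAdd k₁ i)
  have hp : ∀ s₁ s₂, ∃ s, p₁ s = s₁ ∧ p₂ s = s₂ := fun s₁ s₂ =>
    ⟨Fin.append s₁ s₂, funext fun i => Fin.append_left s₁ s₂ i,
      funext fun i => Fin.append_right s₁ s₂ i⟩
  have hpinj : ∀ s, p₁ s = 0 → p₂ s = 0 → s = 0 := by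
    intro s h₁ h₂
    funext i
    refine Fin.addCases (fun j => congrFun h₁ j) (fun j => congrFun h₂ j) i
  let γ : (Fin (k₁ + k₂) → 𝕜) → M₁ × M₂ := fun t => (γ₁ (p₁ t), γ₂ (p₂ t))
  have hU : IsOpen (p₁ ⁻¹' U₁ ∩ p₂ ⁻¹' U₂) :=
    (hU₁.preimage p₁.continuous).inter (hU₂.preimage p₂.continuous)
  have hγ : ContMDiffOn 𝓘(𝕜, Fin (k₁ + k₂) → 𝕜) (I₁.prod I₂) r γ (p₁ ⁻¹' U₁ ∩ p₂ ⁻¹' U₂) :=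
    (hγ₁.comp p₁.contDiff.contMDiff.contMDiffOn fun t ht => ht.1).prodMk
      (hγ₂.comp p₂.contDiff.contMDiff.contMDiffOn fun t ht => ht.2)
  refine ⟨k₁ + k₂, p₁ ⁻¹' U₁ ∩ p₂ ⁻¹' U₂, γ, hU, ⟨?_, ?_⟩, ?_, hγ, fun t ht => ?_⟩
  · simpa using h0₁
  · simpa using h0₂
  · simp [γ]
  have hγt : MDifferentiableAt 𝓘(𝕜, Fin (k₁ + k₂) → 𝕜) (I₁.prod I₂) γ t :=
    (hγ.contMDiffAt (hU.mem_nhds ht)).mdifferentiableAt hr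
  have hd₁ : ∀ s, mfderiv (I₁.prod I₂) I₁ Prod.fst (γ t)
      (mfderiv 𝓘(𝕜, Fin (k₁ + k₂) → 𝕜) (I₁.prod I₂) γ t s)
      = mfderiv 𝓘(𝕜, Fin k₁ → 𝕜) I₁ γ₁ (p₁ t) (p₁ s) := by
    intro s
    have e₁ := mfderiv_comp_apply t (mdifferentiableAt_fst (I := I₁) (I' := I₂)) hγt s
    have e₂ := mfderiv_comp_apply (I := 𝓘(𝕜, Fin (k₁ + k₂) → 𝕜)) t
      ((hγ₁.contMDiffAt (hU₁.mem_nhds ht.1)).mdifferentiableAt hr)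
      p₁.differentiableAt.mdifferentiableAt s
    rw [mfderiv_eq_fderiv, p₁.fderiv] at e₂
    exact e₁.symm.trans e₂
  have hd₂ : ∀ s, mfderiv (I₁.prod I₂) I₂ Prod.snd (γ t)
      (mfderiv 𝓘(𝕜, Fin (k₁ + k₂) → 𝕜) (I₁.prod I₂) γ t s)
      = mfderiv 𝓘(𝕜, Fin k₂ → 𝕜) I₂ γ₂ (p₂ t) (p₂ s) := by
    intro s
    have e₁ := mfderiv_comp_apply t (mdifferentiableAt_snd (I := I₁) (I' := I₂)) hγt s
    have e₂ := mfderiv_comp_apply (I := 𝓘(𝕜, Fin (k₁ + k₂) → 𝕜)) t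
      ((hγ₂.contMDiffAt (hU₂.mem_nhds ht.2)).mdifferentiableAt hr)
      p₂.differentiableAt.mdifferentiableAt s
    rw [mfderiv_eq_fderiv, p₂.fderiv] at e₂
    exact e₁.symm.trans e₂
  obtain ⟨hi₁, hr₁⟩ := hγU₁ _ ht.1
  obtain ⟨hi₂, hr₂⟩ := hγU₂ _ ht.2
  refine ⟨(injective_iff_map_eq_zero _).2 fun s hs => hpinj s ?_ ?_, fun v => ?_⟩
  · refine (injective_iff_map_eq_zero _).1 hi₁ _ ?_
    rw [← hd₁, hs, map_zero]
  · refine (injective_iff_map_eq_zero _).1 hi₂ _ ?_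
    rw [← hd₂, hs, map_zero]
  · rw [h (γ t) v]
    constructor
    · rintro ⟨hv₁, hv₂⟩
      obtain ⟨s₁, hs₁⟩ := (hr₁ _).1 hv₁
      obtain ⟨s₂, hs₂⟩ := (hr₂ _).1 hv₂
      obtain ⟨s, rfl, rfl⟩ := hp s₁ s₂
      exact ⟨s, tangent_prod_ext ((hd₁ s).trans hs₁) ((hd₂ s).trans hs₂)⟩
    · rintro ⟨s, rfl⟩
      exact ⟨(hr₁ _).2 ⟨p₁ s, (hd₁ s).symm⟩, (hr₂ _).2 ⟨p₂ s, (hd₂ s).symm⟩⟩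

/-- A direct product of distributions is integrable if and only if both factors are. -/
theorem Distribution.IsProd.isIntegrable_iff [FiniteDimensional 𝕜 E₁] [FiniteDimensional 𝕜 E₂]
    [Nonempty M₁] [Nonempty M₂] (hr : 1 ≤ r) (h : F.IsProd F' F'') :
    F.IsIntegrable ↔ F'.IsIntegrable ∧ F''.IsIntegrable :=
  ⟨fun hF => ⟨hF.of_map hr contMDiff_fst Prod.fst_surjective h.map_fst,
    hF.of_map hr contMDiff_snd Prod.snd_surjective h.map_snd⟩,
    fun hF => h.isIntegrable (lt_of_lt_of_le zero_lt_one hr).ne' hF.1 hF.2⟩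

end Product

end BiHam

theorem theoremT {𝕜 : Type*} [RCLike 𝕜] (r : ℕ∞ω) (hr : r = ∞ ∨ r = ω)
    {E' : Type*} [NormedAddCommGroup E'] [NormedSpace 𝕜 E'] [FiniteDimensional 𝕜 E']
    {M' : Type*} [TopologicalSpace M'] [T2Space M'] [SecondCountableTopology M']
    [ConnectedSpace M'] [ChartedSpace E' M']
    [IsManifold 𝓘(𝕜, E') 1 M'] [IsManifold 𝓘(𝕜, E') r M']
    {E'' : Type*} [NormedAddCommGroup E''] [NormedSpace 𝕜 E''] [FiniteDimensional 𝕜 E'']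
    {M'' : Type*} [TopologicalSpace M''] [T2Space M''] [SecondCountableTopology M'']
    [ConnectedSpace M''] [ChartedSpace E'' M'']
    [IsManifold 𝓘(𝕜, E'') 1 M''] [IsManifold 𝓘(𝕜, E'') r M'']
    (ω₀' ω₁' : BiHam.BilinField 𝓘(𝕜, E') M') (ω₀'' ω₁'' : BiHam.BilinField 𝓘(𝕜, E'') M'')
    (h' : BiHam.IsCompatiblePair r ω₀' ω₁') (h'' : BiHam.IsCompatiblePair r ω₀'' ω₁'')
    (hcoprime : ∀ (x' : M') (x'' : M''),
      IsCoprime (BiHam.charPolyAt ω₀' ω₁' x') (BiHam.charPolyAt ω₀'' ω₁'' x''))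
    (F : BiHam.Distribution (𝓘(𝕜, E').prod 𝓘(𝕜, E'')) (M' × M'') r)
    (hF : F.IsInvariant (ω₀'.prod ω₀'') (ω₁'.prod ω₁'')) :
    (∃ (F' : BiHam.Distribution 𝓘(𝕜, E') M' r) (F'' : BiHam.Distribution 𝓘(𝕜, E'') M'' r),
      F'.IsInvariant ω₀' ω₁' ∧ F''.IsInvariant ω₀'' ω₁'' ∧ F.IsProd F' F'') ∧
    ∀ (F' : BiHam.Distribution 𝓘(𝕜, E') M' r) (F'' : BiHam.Distribution 𝓘(𝕜, E'') M'' r),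
      F.IsProd F' F'' → (F.IsIntegrable ↔ F'.IsIntegrable ∧ F''.IsIntegrable) := by
  have hr1 : 1 ≤ r := by
    rcases hr with rfl | rfl
    · exact_mod_cast le_top
    · exact le_top
  exact ⟨hF.exists_isProd h' h'', fun F' F'' h => h.isIntegrable_iff hr1⟩
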